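/- Let $N\ge 1$, $s\in(0,1)$, $p\in(1,\infty)$, and let $\Omega\subset\mathbb R^N$ be a bounded domain with Lipschitz boundary. Put $C\Omega=\mathbb R^N\setminus\Omega$, $\mathcal Q=\mathbb R^{2N}\setminus (C\Omega)^2$, $J_p(t)=|t|^{p-2}t$ (with $J_p(0)=0$), and let $X$ be the space of measurable $u:\mathbb R^N\to\mathbb R$ with $$\|u\|:=\left(\iint_{\mathcal Q}\frac{|u(x)-u(y)|^p}{|x-y|^{N+ps}}\,dx\,dy+\|u\|_{L^p(\Omega)}^p\right)^{1/p}<\infty .$$ Let $g:\Omega\times\mathbb R\to\mathbb R$ be a Carathéodory function ($x\mapsto g(x,t)$ is measurable for every $t\in\mathbb R$, and $t\mapsto g(x,t)$ is continuous for a.e. $x\in\Omega$) for which there exist $a\in L^{p'}(\Omega)$, $p'=p/(p-1)$, and $b\in\mathbb R$ with $$|g(x,t)|\le a(x)+b|t|^{p-1}\quad\text{for every } t\in\mathbb R \text{ and a.e. } x\in\Omega ,$$ and suppose that $$\limsup_{|t|\to\infty}\frac{g(x,t)}{|t|^{p-2}t}<0\quad\text{for a.e. } x\in\Omega .$$ Then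 the Neumann problem $$(-\Delta)^s_p u=g(x,u)\ \text{ in }\Omega,\qquad \mathscr N_{s,p}u(x):=\int_\Omega\frac{J_p(u(x)-u(y))}{|x-y|^{N+ps}}\,dy=0\ \text{ in }\mathbb R^N\setminus\overline\Omega$$ has a weak solution, that is, there is $u\in X$ such that for every $v\in X$ both integrals below converge absolutely and $$\frac12\iint_{\mathcal Q}\frac{J_p(u(x)-u(y))\,(v(x)-v(y))}{|x-y|^{N+ps}}\,dx\,dy=\int_\Omega g(x,u)\,v\,dx .$$ Moreover, $u$ can be chosen to be a global minimizer on $X$ of the energy $$I(w)=\frac1{2p}\iint_{\mathcal Q}\frac{|w(x)-w(y)|^p}{|x-y|^{N+ps}}\,dx\,dy-\int_\Omega G(x,w)\,dx,\qquad G(x,t)=\int_0^t g(x,\tau)\,d\tau ,$$ both integrals being finite for every $w\in X$. -/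

import Mathlib

open MeasureTheory Filter Topology Set
open scoped ENNReal NNReal

noncomputable section

namespace FracNeumann

/-- Euclidean space `ℝ^N`, with Lebesgue measure `volume`. -/
abbrev E (N : ℕ) : Type := EuclideanSpace ℝ (Fin N)

/-- `Ω` has Lipschitz boundary: near each boundary point, in the direction of some unit vector `e`,
the set `Ω` is the strict epigraph of a Lipschitz function `γ` on the hyperplane orthogonal to
`e`. -/
def HasLipschitzBoundary {N : ℕ} (Ω : Set (E N)) : Prop :=
  ∀ x₀ ∈ frontier Ω, ∃ r : ℝ, 0 < r ∧ ∃ e : E N, ‖e‖ = 1 ∧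
    ∃ (K : ℝ≥0) (γ : (Submodule.span ℝ {e})ᗮ → ℝ), LipschitzWith K γ ∧
      ∀ x ∈ Metric.ball x₀ r,
        (x ∈ Ω ↔ γ ((Submodule.span ℝ {e})ᗮ.orthogonalProjectionOnto x) < inner ℝ e x)

/-- A bounded domain (nonempty, connected, open set) with Lipschitz boundary. -/
structure IsBoundedLipschitzDomain {N : ℕ} (Ω : Set (E N)) : Prop where
  isOpen : IsOpen Ω
  isConnected : IsConnected Ω
  isBounded : Bornology.IsBounded Ω
  lipschitz : HasLipschitzBoundary Ω

/-- `Q = ℝ^{2N} \ (CΩ)²`, where `CΩ = ℝ^N \ Ω`. -/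
def Q {N : ℕ} (Ω : Set (E N)) : Set (E N × E N) := (Ωᶜ ×ˢ Ωᶜ)ᶜ

/-- The singular weight `|x - y|^{N + ps}` at `z = (x, y)`. -/
def weight (N : ℕ) (s p : ℝ) (z : E N × E N) : ℝ := ‖z.1 - z.2‖ ^ ((N : ℝ) + p * s)

/-- `J_p(t) = |t|^{p-2} t` (which is `0` at `t = 0`). -/
def J (p t : ℝ) : ℝ := |t| ^ (p - 2) * t

/-- The norm `‖u‖ = (∬_Q |u(x) - u(y)|^p / |x - y|^{N+ps} dx dy + ‖u‖_{L^p(Ω)}^p)^{1/p}`,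
with values in `[0, ∞]`. -/
def xNorm {N : ℕ} (s p : ℝ) (Ω : Set (E N)) (u : E N → ℝ) : ℝ≥0∞ :=
  ((∫⁻ z in Q Ω, ENNReal.ofReal (|u z.1 - u z.2| ^ p / weight N s p z))
    + ∫⁻ x in Ω, ENNReal.ofReal (|u x| ^ p)) ^ (1 / p)

/-- Membership in the space `X` of (Lebesgue) measurable `u : ℝ^N → ℝ` with `‖u‖ < ∞`. -/
def MemX {N : ℕ} (s p : ℝ) (Ω : Set (E N)) (u : E N → ℝ) : Prop :=
  AEMeasurable u volume ∧ xNorm s p Ω u < ∞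

/-- `g : Ω × ℝ → ℝ` is a Carathéodory function (values of `g` off `Ω` are irrelevant). -/
structure IsCaratheodory {N : ℕ} (Ω : Set (E N)) (g : E N → ℝ → ℝ) : Prop where
  measurable : ∀ t : ℝ, AEMeasurable (fun x => g x t) (volume.restrict Ω)
  continuous : ∀ᵐ x ∂(volume.restrict Ω), Continuous (g x)

/-- `g` has `p`-linear growth: `|g(x,t)| ≤ a(x) + b |t|^{p-1}` with `a ∈ L^{p'}(Ω)`,
`p' = p / (p - 1)`, and `b ∈ ℝ`. -/
def HasPLinearGrowth {N : ℕ} (p : ℝ) (Ω : Set (E N)) (g : E N → ℝ → ℝ) : Prop :=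
  ∃ (a : E N → ℝ) (b : ℝ), MemLp a (ENNReal.ofReal (p / (p - 1))) (volume.restrict Ω) ∧
    ∀ t : ℝ, ∀ᵐ x ∂(volume.restrict Ω), |g x t| ≤ a x + b * |t| ^ (p - 1)

/-- `limsup_{|t| → ∞} g(x,t) / (|t|^{p-2} t)`, as an extended real number. -/
def alphaBar {N : ℕ} (p : ℝ) (g : E N → ℝ → ℝ) (x : E N) : EReal :=
  limsup (fun t : ℝ => ((g x t / (|t| ^ (p - 2) * t) : ℝ) : EReal))
    (comap (fun t : ℝ => |t|) atTop)

/-- `u` is a weak solution of `(-Δ)^s_p u = g(x,u)` in `Ω`, `𝒩_{s,p} u = 0` in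
`ℝ^N \ closure Ω`. That both integrals make sense is part of the definition. -/
def IsWeakSolution {N : ℕ} (s p : ℝ) (Ω : Set (E N)) (g : E N → ℝ → ℝ) (u : E N → ℝ) : Prop :=
  MemX s p Ω u ∧ ∀ v : E N → ℝ, MemX s p Ω v →
    IntegrableOn (fun z : E N × E N =>
      J p (u z.1 - u z.2) * (v z.1 - v z.2) / weight N s p z) (Q Ω) ∧
    IntegrableOn (fun x => g x (u x) * v x) Ω ∧
    (1 / 2) * ∫ z in Q Ω, J p (u z.1 - u z.2) * (v z.1 - v z.2) / weight N s p z
      = ∫ x in Ω, g x (u x) * v x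

/-- The primitive `G(x,t) = ∫_0^t g(x,τ) dτ`. -/
def primitive {N : ℕ} (g : E N → ℝ → ℝ) (x : E N) (t : ℝ) : ℝ := ∫ τ in (0 : ℝ)..t, g x τ

/-- The energy
`I(u) = 1/(2p) ∬_Q |u(x) - u(y)|^p / |x - y|^{N+ps} dx dy - ∫_Ω G(x,u) dx`. -/
def energy {N : ℕ} (s p : ℝ) (Ω : Set (E N)) (g : E N → ℝ → ℝ) (u : E N → ℝ) : ℝ :=
  1 / (2 * p) * (∫ z in Q Ω, |u z.1 - u z.2| ^ p / weight N s p z)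
    - ∫ x in Ω, primitive g x (u x)

/-- `u` minimizes the energy over all of `X`; that the energy is well defined (both integrals
converge) on all of `X` is part of the definition. -/
def IsGlobalMinimizer {N : ℕ} (s p : ℝ) (Ω : Set (E N)) (g : E N → ℝ → ℝ)
    (u : E N → ℝ) : Prop :=
  MemX s p Ω u ∧ ∀ v : E N → ℝ, MemX s p Ω v →
    IntegrableOn (fun z : E N × E N => |v z.1 - v z.2| ^ p / weight N s p z) (Q Ω) ∧
    IntegrableOn (fun x => primitive g x (v x)) Ω ∧
    energy s p Ω g u ≤ energy s p Ω g v

end FracNeumann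

end

/-! The proof is the direct method: a minimizer $u$ of $I$ exists, and the derivative of $t\mapsto
I(u+tv)$ at $0$ gives the weak equation (`isWeakSolution_of_minimizer`). Three points carry it.

Compactness (`exists_subseq_tendsto`). Since $\mathcal Q\supseteq\Omega\times\mathbb R^N$, the
energy controls $u(x)-u(y)$ for $x\in\Omega$ and every $y$. So averages over cubes of side $h$
approximate $u$ in $L^p(\Omega)$, the $p$-th power of the error being $O(h^{ps})$ times the energy,
even for cubes that leave $\Omega$. Along a subsequence all averages converge, and that subsequence
is Cauchy.

Coercivity (`exists_sublevel_bound`). The limsup is negative pointwise, not uniformly, so only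
$G(x,t)\le c(x)-\delta(x)|t|^p$ is available. An unbounded sequence with $I\le 0$ is normalised and
converges in $L^p(\Omega)$; Fatou's lemma forces its limit to vanish. All the mass then sits in the
Gagliardo part, which $I\le 0$ bounds by a potential part with vanishing upper bound: a
contradiction.

Lower semicontinuity (`exists_extension_gagl_le_liminf`). A minimizing sequence converges only on
$\Omega$. At each other $y$ separately, indices are selected along which the inner integral over
$\Omega$ nearly attains its liminf, and a limit point of the values at $y$ extends the limit. Fatou
in $x$, then in $y$, concludes. The potential is upper semicontinuous by Fatou and $L^p$ convergence
(`eventually_integral_primitive_lt`). -/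

noncomputable section

namespace FracNeumann

variable {N : ℕ} {s p : ℝ} {Ω : Set (E N)} {g : E N → ℝ → ℝ}

/-! ### Gagliardo energy and the linear structure of $X$. -/

/-- The Gagliardo kernel of `u`. -/
def kernel (s p : ℝ) (u : E N → ℝ) (z : E N × E N) : ℝ :=
  |u z.1 - u z.2| ^ p / weight N s p z

/-- The Gagliardo energy `∬_Q |u(x) - u(y)|^p / |x - y|^{N+ps}`. -/
def gagl (s p : ℝ) (Ω : Set (E N)) (u : E N → ℝ) : ℝ≥0∞ :=
  ∫⁻ z in Q Ω, ENNReal.ofReal (kernel s p u z)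

/-- The `p`-th power of the `L^p(Ω)` norm. -/
def lpPow (p : ℝ) (Ω : Set (E N)) (u : E N → ℝ) : ℝ≥0∞ :=
  ∫⁻ x in Ω, ENNReal.ofReal (|u x| ^ p)

lemma weight_nonneg (z : E N × E N) : 0 ≤ weight N s p z := Real.rpow_nonneg (norm_nonneg _) _

lemma weight_swap (x y : E N) : weight N s p (x, y) = weight N s p (y, x) := by
  simp [weight, norm_sub_rev]

lemma measurable_weight : Measurable (weight N s p) := by
  unfold weight
  exact (measurable_fst.sub measurable_snd).norm.pow_const _

lemma kernel_nonneg (u : E N → ℝ) (z : E N × E N) : 0 ≤ kernel s p u z :=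
  div_nonneg (Real.rpow_nonneg (abs_nonneg _) _) (weight_nonneg _)

lemma kernel_swap (u : E N → ℝ) (x y : E N) : kernel s p u (x, y) = kernel s p u (y, x) := by
  simp only [kernel, weight_swap x y, abs_sub_comm (u x)]

lemma memX_iff (hp : 0 < p) {u : E N → ℝ} :
    MemX s p Ω u ↔ AEMeasurable u volume ∧ gagl s p Ω u < ∞ ∧ lpPow p Ω u < ∞ := by
  unfold MemX xNorm
  rw [ENNReal.rpow_lt_top_iff_of_pos (by positivity), ENNReal.add_lt_top]
  rfl

lemma aemeasurable_diff {u : E N → ℝ} (hu : AEMeasurable u volume) :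
    AEMeasurable (fun z : E N × E N => u z.1 - u z.2) volume :=
  AEMeasurable.sub (hu.comp_quasiMeasurePreserving Measure.quasiMeasurePreserving_fst)
    (hu.comp_quasiMeasurePreserving Measure.quasiMeasurePreserving_snd)

lemma aemeasurable_kernel {u : E N → ℝ} (hu : AEMeasurable u volume) :
    AEMeasurable (kernel s p u) volume :=
  ((aemeasurable_diff hu).abs.pow_const p).div measurable_weight.aemeasurable

lemma measurable_kernel {u : E N → ℝ} (hu : Measurable u) : Measurable (kernel s p u) :=
  (((hu.comp measurable_fst).sub (hu.comp measurable_snd)).abs.pow_const p).div measurable_weight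

lemma kernel_congr {u v : E N → ℝ} (h : u =ᵐ[volume] v) :
    kernel s p u =ᵐ[volume] kernel s p v := by
  have h1 := (Measure.quasiMeasurePreserving_fst (μ := (volume : Measure (E N)))
    (ν := (volume : Measure (E N)))).ae h
  have h2 := (Measure.quasiMeasurePreserving_snd (μ := (volume : Measure (E N)))
    (ν := (volume : Measure (E N)))).ae h
  filter_upwards [h1, h2] with z h1 h2
  simp only [kernel, h1, h2]

lemma gagl_congr {u v : E N → ℝ} (h : u =ᵐ[volume] v) : gagl s p Ω u = gagl s p Ω v := by
  refine lintegral_congr_ae (ae_restrict_of_ae ?_)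
  filter_upwards [kernel_congr (s := s) (p := p) h] with z hz
  rw [hz]

lemma lpPow_congr {u v : E N → ℝ} (h : u =ᵐ[volume.restrict Ω] v) :
    lpPow p Ω u = lpPow p Ω v := by
  refine lintegral_congr_ae ?_
  filter_upwards [h] with z hz
  rw [hz]

lemma memX_congr {u v : E N → ℝ} (hp : 0 < p) (h : u =ᵐ[volume] v) (hu : MemX s p Ω u) :
    MemX s p Ω v := by
  rw [memX_iff hp] at hu ⊢
  rw [← gagl_congr h, ← lpPow_congr (ae_restrict_of_ae h)]
  exact ⟨hu.1.congr h, hu.2⟩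

lemma energy_congr {u v : E N → ℝ} {g : E N → ℝ → ℝ} (h : u =ᵐ[volume] v) :
    energy s p Ω g u = energy s p Ω g v := by
  have h1 : ∫ z in Q Ω, kernel s p u z = ∫ z in Q Ω, kernel s p v z :=
    integral_congr_ae (ae_restrict_of_ae (kernel_congr h))
  have h2 : ∫ x in Ω, primitive g x (u x) = ∫ x in Ω, primitive g x (v x) := by
    refine integral_congr_ae (ae_restrict_of_ae ?_)
    filter_upwards [h] with x hx
    rw [hx]
  unfold kernel at h1
  unfold energy
  rw [h1, h2]

lemma integral_kernel {u : E N → ℝ} (hu : AEMeasurable u volume) :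
    ∫ z in Q Ω, kernel s p u z = (gagl s p Ω u).toReal :=
  integral_eq_lintegral_of_nonneg_ae (Eventually.of_forall (kernel_nonneg u))
    (aemeasurable_kernel hu).restrict.aestronglyMeasurable

lemma integrableOn_kernel {u : E N → ℝ} (hu : AEMeasurable u volume)
    (h : gagl s p Ω u < ∞) : IntegrableOn (kernel s p u) (Q Ω) :=
  ⟨(aemeasurable_kernel hu).restrict.aestronglyMeasurable,
    (hasFiniteIntegral_iff_ofReal (Eventually.of_forall (kernel_nonneg u))).2 h⟩

lemma integrableOn_pow {u : E N → ℝ} (hu : AEMeasurable u (volume.restrict Ω))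
    (h : lpPow p Ω u < ∞) : IntegrableOn (fun x => |u x| ^ p) Ω :=
  ⟨(hu.abs.pow_const p).aestronglyMeasurable,
    (hasFiniteIntegral_iff_ofReal (Eventually.of_forall
      fun _ => Real.rpow_nonneg (abs_nonneg _) _)).2 h⟩

lemma integral_pow {u : E N → ℝ} (hu : AEMeasurable u (volume.restrict Ω)) :
    ∫ x in Ω, |u x| ^ p = (lpPow p Ω u).toReal :=
  integral_eq_lintegral_of_nonneg_ae
    (Eventually.of_forall fun _ => Real.rpow_nonneg (abs_nonneg _) _)
    (hu.abs.pow_const p).aestronglyMeasurable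

lemma energy_eq {u : E N → ℝ} {g : E N → ℝ → ℝ} (hu : AEMeasurable u volume) :
    energy s p Ω g u = 1 / (2 * p) * (gagl s p Ω u).toReal - ∫ x in Ω, primitive g x (u x) := by
  rw [← integral_kernel hu]; rfl

lemma abs_add_rpow_le (hp : 0 < p) (a b : ℝ) :
    (|a| + |b|) ^ p ≤ 2 ^ p * (|a| ^ p + |b| ^ p) := by
  have ha := Real.rpow_nonneg (abs_nonneg a) p
  have hb := Real.rpow_nonneg (abs_nonneg b) p
  rcases le_total |a| |b| with h | h
  · calc (|a| + |b|) ^ p ≤ (2 * |b|) ^ p :=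
          Real.rpow_le_rpow (by positivity) (by linarith) hp.le
      _ = 2 ^ p * |b| ^ p := Real.mul_rpow (by norm_num) (abs_nonneg _)
      _ ≤ _ := by gcongr; linarith
  · calc (|a| + |b|) ^ p ≤ (2 * |a|) ^ p :=
          Real.rpow_le_rpow (by positivity) (by linarith) hp.le
      _ = 2 ^ p * |a| ^ p := Real.mul_rpow (by norm_num) (abs_nonneg _)
      _ ≤ _ := by gcongr; linarith

lemma abs_rpow_le_of_abs_le_add (hp : 0 < p) {a b c : ℝ} (h : |a| ≤ |b| + |c|) :
    |a| ^ p ≤ 2 ^ p * (|b| ^ p + |c| ^ p) :=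
  (Real.rpow_le_rpow (abs_nonneg _) h hp.le).trans (abs_add_rpow_le hp b c)

lemma kernel_smul (c : ℝ) (u : E N → ℝ) (z : E N × E N) :
    kernel s p (fun x => c * u x) z = |c| ^ p * kernel s p u z := by
  simp only [kernel]
  rw [← mul_sub, abs_mul, Real.mul_rpow (abs_nonneg _) (abs_nonneg _), mul_div_assoc]

lemma gagl_smul (c : ℝ) (u : E N → ℝ) :
    gagl s p Ω (fun x => c * u x) = ENNReal.ofReal (|c| ^ p) * gagl s p Ω u := by
  unfold gagl
  rw [← lintegral_const_mul' _ _ ENNReal.ofReal_ne_top]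
  simp_rw [kernel_smul, ENNReal.ofReal_mul (Real.rpow_nonneg (abs_nonneg c) p)]

lemma lpPow_smul (c : ℝ) (u : E N → ℝ) :
    lpPow p Ω (fun x => c * u x) = ENNReal.ofReal (|c| ^ p) * lpPow p Ω u := by
  unfold lpPow
  rw [← lintegral_const_mul' _ _ ENNReal.ofReal_ne_top]
  simp_rw [abs_mul, Real.mul_rpow (abs_nonneg c) (abs_nonneg _),
    ENNReal.ofReal_mul (Real.rpow_nonneg (abs_nonneg c) p)]

lemma memX_smul (hp : 0 < p) (c : ℝ) {u : E N → ℝ} (hu : MemX s p Ω u) :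
    MemX s p Ω (fun x => c * u x) := by
  rw [memX_iff hp] at hu ⊢
  rw [gagl_smul, lpPow_smul]
  exact ⟨hu.1.const_mul c, ENNReal.mul_lt_top ENNReal.ofReal_lt_top hu.2.1,
    ENNReal.mul_lt_top ENNReal.ofReal_lt_top hu.2.2⟩

/-- The sum of absolute values on the left serves both the sum `u + v` and the dominated
differentiation along `u + t v`, $|t|<1$. -/
lemma kernel_add_le (hp : 0 < p) (u v : E N → ℝ) (z : E N × E N) :
    (|u z.1 - u z.2| + |v z.1 - v z.2|) ^ p / weight N s p z
      ≤ 2 ^ p * (kernel s p u z + kernel s p v z) := by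
  simp only [kernel]
  rw [← add_div, ← mul_div_assoc]
  exact div_le_div_of_nonneg_right (abs_add_rpow_le hp _ _) (weight_nonneg z)

lemma memX_add (hp : 0 < p) {u v : E N → ℝ} (hu : MemX s p Ω u) (hv : MemX s p Ω v) :
    MemX s p Ω (fun x => u x + v x) := by
  rw [memX_iff hp] at hu hv ⊢
  refine ⟨hu.1.add hv.1, ?_, ?_⟩
  · refine (lintegral_mono (g := fun z => ENNReal.ofReal (2 ^ p *
      (kernel s p u z + kernel s p v z))) fun z => ENNReal.ofReal_le_ofReal ?_).trans_lt ?_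
    · refine le_trans ?_ (kernel_add_le hp u v z)
      refine div_le_div_of_nonneg_right
        (Real.rpow_le_rpow (abs_nonneg _) ?_ hp.le) (weight_nonneg z)
      rw [add_sub_add_comm]
      exact abs_add_le _ _
    · exact (((integrableOn_kernel hu.1 hu.2.1).add
        (integrableOn_kernel hv.1 hv.2.1)).const_mul (2 ^ p)).lintegral_lt_top
  · refine (lintegral_mono (g := fun x => ENNReal.ofReal (2 ^ p *
      (|u x| ^ p + |v x| ^ p))) fun z => ENNReal.ofReal_le_ofReal ?_).trans_lt ?_
    · exact abs_rpow_le_of_abs_le_add hp (abs_add_le _ _)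
    · exact (((integrableOn_pow hu.1.restrict hu.2.2).add
        (integrableOn_pow hv.1.restrict hv.2.2)).const_mul (2 ^ p)).lintegral_lt_top

/-! ### Slices of the energy and local integrability. -/

/-- The Gagliardo energy as an iterated integral whose inner variable runs over `Ω`. -/
lemma gagl_eq_iterated (hΩ : MeasurableSet Ω) {u : E N → ℝ} (hu : Measurable u) :
    gagl s p Ω u = (∫⁻ y, ∫⁻ x in Ω, ENNReal.ofReal (kernel s p u (y, x)))
      + ∫⁻ y in Ωᶜ, ∫⁻ x in Ω, ENNReal.ofReal (kernel s p u (y, x)) := by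
  have hm : Measurable fun z => ENNReal.ofReal (kernel s p u z) :=
    (measurable_kernel hu).ennreal_ofReal
  have hQ : Q Ω = (Ω ×ˢ (univ : Set (E N))) ∪ (Ωᶜ ×ˢ Ω) := by
    ext z
    simp only [Q, mem_compl_iff, mem_prod, mem_union, mem_univ]
    tauto
  have hd : Disjoint (Ω ×ˢ (univ : Set (E N))) (Ωᶜ ×ˢ Ω) := by
    rw [Set.disjoint_left]
    rintro z ⟨h, -⟩ ⟨h', -⟩
    exact h' h
  unfold gagl
  rw [hQ, lintegral_union (hΩ.compl.prod hΩ) hd]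
  congr 1
  -- The variable in `Ω` comes first here; Tonelli in the reverse order and the symmetry of the
  -- kernel make it the inner one.
  · rw [Measure.volume_eq_prod, ← Measure.prod_restrict, Measure.restrict_univ,
      lintegral_prod_symm _ hm.aemeasurable]
    simp_rw [kernel_swap u]
  · rw [Measure.volume_eq_prod, setLIntegral_prod _ hm.aemeasurable]

/-- The inner integral of the Gagliardo energy. -/
def slice (s p : ℝ) (Ω : Set (E N)) (u : E N → ℝ) (y : E N) : ℝ≥0∞ :=
  ∫⁻ x in Ω, ENNReal.ofReal (kernel s p u (y, x))

lemma measurable_slice {u : E N → ℝ} (hu : Measurable u) : Measurable (slice s p Ω u) :=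
  (measurable_kernel hu).ennreal_ofReal.lintegral_prod_right'

/-- A point outside `Ω` counts twice, because its pairs with `Ω` lie in `Q` in both orders. With a
single measure, Fatou's lemma in `y` applies once. -/
lemma gagl_eq_slice (hΩ : MeasurableSet Ω) {u : E N → ℝ} (hu : Measurable u) :
    gagl s p Ω u = ∫⁻ y, slice s p Ω u y ∂(volume + volume.restrict Ωᶜ) := by
  rw [lintegral_add_measure, gagl_eq_iterated hΩ hu]; rfl

lemma lintegral_slice_le (hΩ : MeasurableSet Ω) {u : E N → ℝ} (hu : Measurable u) :
    ∫⁻ y, slice s p Ω u y ≤ gagl s p Ω u := by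
  rw [gagl_eq_iterated hΩ hu]
  exact le_self_add

/-- Used at two scales: `R` bounding distances to `Ω`, and `R` bounding the diameter of a small
cube. -/
lemma diff_rpow_le (hp : 0 < p) (hs : 0 < s) (u : E N → ℝ) {x y : E N} {R : ℝ}
    (h : ‖x - y‖ ≤ R) :
    |u x - u y| ^ p ≤ R ^ ((N : ℝ) + p * s) * kernel s p u (x, y) := by
  have hq : 0 < (N : ℝ) + p * s := by positivity
  rcases eq_or_ne x y with rfl | hxy
  · simp [kernel, Real.zero_rpow hp.ne']
  · have hw : 0 < weight N s p (x, y) :=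
      Real.rpow_pos_of_pos (norm_pos_iff.2 (sub_ne_zero.2 hxy)) _
    have hle : weight N s p (x, y) ≤ R ^ ((N : ℝ) + p * s) :=
      Real.rpow_le_rpow (norm_nonneg _) h hq.le
    calc |u x - u y| ^ p = weight N s p (x, y) * kernel s p u (x, y) := by
          simp only [kernel]; field_simp
      _ ≤ _ := mul_le_mul_of_nonneg_right hle (kernel_nonneg _ _)

/-- Integrate $|u(y)|^p\le 2^p(|u(x)|^p+|u(y)-u(x)|^p)$ over $x\in\Omega$. The bound holds at every
single `y`, as the pointwise selection outside `Ω` requires. -/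
lemma rpow_mul_volume_le (hp : 0 < p) (hs : 0 < s) (hΩ : MeasurableSet Ω) {u : E N → ℝ}
    (hu : Measurable u) {y : E N} {R : ℝ} (hR : ∀ x ∈ Ω, ‖y - x‖ ≤ R) :
    ENNReal.ofReal (|u y| ^ p) * volume Ω ≤ ENNReal.ofReal (2 ^ p) *
      (lpPow p Ω u + ENNReal.ofReal (R ^ ((N : ℝ) + p * s)) * slice s p Ω u y) := by
  have hpt : ∀ x ∈ Ω, ENNReal.ofReal (|u y| ^ p) ≤ ENNReal.ofReal (2 ^ p) *
      (ENNReal.ofReal (|u x| ^ p) + ENNReal.ofReal (R ^ ((N : ℝ) + p * s)) *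
        ENNReal.ofReal (kernel s p u (y, x))) := by
    intro x hx
    have hR0 : 0 ≤ R := (norm_nonneg _).trans (hR x hx)
    rw [← ENNReal.ofReal_mul (Real.rpow_nonneg hR0 _),
      ← ENNReal.ofReal_add (by positivity)
        (mul_nonneg (Real.rpow_nonneg hR0 _) (kernel_nonneg _ _)),
      ← ENNReal.ofReal_mul (by positivity)]
    refine ENNReal.ofReal_le_ofReal ((abs_rpow_le_of_abs_le_add hp
      (b := u x) (c := u y - u x) ?_).trans ?_)
    · calc |u y| = |u x + (u y - u x)| := by ring_nf
        _ ≤ _ := abs_add_le _ _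
    · gcongr
      exact diff_rpow_le hp hs u (hR x hx)
  have hm : Measurable fun x => ENNReal.ofReal (|u x| ^ p) :=
    (hu.abs.pow_const p).ennreal_ofReal
  calc ENNReal.ofReal (|u y| ^ p) * volume Ω
      = ∫⁻ _ in Ω, ENNReal.ofReal (|u y| ^ p) := by simp
    _ ≤ _ := setLIntegral_mono' hΩ hpt
    _ = _ := by
      rw [lintegral_const_mul' _ _ ENNReal.ofReal_ne_top, lintegral_add_left hm,
        lintegral_const_mul' _ _ ENNReal.ofReal_ne_top]
      rfl

lemma exists_norm_sub_le {A B : Set (E N)} (hA : Bornology.IsBounded A)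
    (hB : Bornology.IsBounded B) : ∃ R : ℝ, ∀ x ∈ A, ∀ y ∈ B, ‖x - y‖ ≤ R := by
  obtain ⟨a, ha⟩ := hA.exists_norm_le
  obtain ⟨b, hb⟩ := hB.exists_norm_le
  exact ⟨a + b, fun x hx y hy => (norm_sub_le _ _).trans (add_le_add (ha x hx) (hb y hy))⟩

/-- Functions in `X` are locally `p`-integrable on the whole space, with a uniform bound. -/
lemma exists_local_bound (hp : 0 < p) (hs : 0 < s) (hΩ : MeasurableSet Ω)
    (hb : Bornology.IsBounded Ω) (h0 : volume Ω ≠ 0) {B : Set (E N)}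
    (hB : Bornology.IsBounded B) :
    ∃ K : ℝ≥0∞, K ≠ ∞ ∧ ∀ u : E N → ℝ, Measurable u → ∀ C : ℝ≥0∞, lpPow p Ω u ≤ C →
      gagl s p Ω u ≤ C → ∫⁻ y in B, ENNReal.ofReal (|u y| ^ p) ≤ K * C := by
  obtain ⟨R, hR⟩ := exists_norm_sub_le hB hb
  set q : ℝ≥0∞ := ENNReal.ofReal (R ^ ((N : ℝ) + p * s))
  have hfin : volume Ω ≠ ∞ := hb.measure_lt_top.ne
  -- The constant of `rpow_mul_volume_le` integrated over `B` and divided by the volume of `Ω`.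
  refine ⟨ENNReal.ofReal (2 ^ p) * (volume B + q) / volume Ω, ?_, ?_⟩
  · refine ENNReal.div_ne_top (ENNReal.mul_ne_top ENNReal.ofReal_ne_top
      (ENNReal.add_ne_top.2 ⟨hB.measure_lt_top.ne, ENNReal.ofReal_ne_top⟩)) h0
  · intro u hu C hC1 hC2
    have hm : Measurable fun x => ENNReal.ofReal (|u x| ^ p) :=
      (hu.abs.pow_const p).ennreal_ofReal
    have hmul : (∫⁻ y in B, ENNReal.ofReal (|u y| ^ p)) * volume Ω
        ≤ ENNReal.ofReal (2 ^ p) * (volume B + q) * C := by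
      rw [← lintegral_mul_const _ hm]
      calc ∫⁻ y in B, ENNReal.ofReal (|u y| ^ p) * volume Ω
          ≤ ∫⁻ y in B, ENNReal.ofReal (2 ^ p) * (lpPow p Ω u + q * slice s p Ω u y) := by
            refine setLIntegral_mono (by
              have := measurable_slice (s := s) (p := p) (Ω := Ω) hu
              fun_prop) fun y hy => ?_
            exact rpow_mul_volume_le hp hs hΩ hu (hR y hy)
        _ = ENNReal.ofReal (2 ^ p) * (lpPow p Ω u * volume B +
              q * ∫⁻ y in B, slice s p Ω u y) := by
            rw [lintegral_const_mul' _ _ ENNReal.ofReal_ne_top,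
              lintegral_add_left measurable_const,
              lintegral_const_mul' _ _ ENNReal.ofReal_ne_top, setLIntegral_const]
        _ ≤ ENNReal.ofReal (2 ^ p) * (C * volume B + q * C) := by
            gcongr
            exact (setLIntegral_le_lintegral _ _).trans ((lintegral_slice_le hΩ hu).trans hC2)
        _ = _ := by ring
    rw [← ENNReal.mul_div_right_comm]
    exact (ENNReal.le_div_iff_mul_le (Or.inl h0) (Or.inl hfin)).2 hmul

/-! ### Lower semicontinuity of the Gagliardo energy. -/

/-- Lower semicontinuity of the Gagliardo energy under a.e. convergence on `Ω` only: the limit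
can be extended to the whole space. -/
lemma exists_extension_gagl_le_liminf (hp : 0 < p) (hs : 0 < s) (hΩ : MeasurableSet Ω)
    (hb : Bornology.IsBounded Ω) (h0 : volume Ω ≠ 0) {u : ℕ → E N → ℝ}
    (hu : ∀ n, Measurable (u n)) {w : E N → ℝ}
    (hw : ∀ᵐ x ∂(volume.restrict Ω), Tendsto (fun n => u n x) atTop (𝓝 (w x)))
    {C : ℝ≥0∞} (hC : C ≠ ∞) (hl : ∀ n, lpPow p Ω (u n) ≤ C) :
    ∃ v : E N → ℝ, Measurable v ∧ v =ᵐ[volume.restrict Ω] w ∧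
      gagl s p Ω v ≤ liminf (fun n => gagl s p Ω (u n)) atTop := by
  classical
  set L : E N → ℝ≥0∞ := fun y => liminf (fun n => slice s p Ω (u n) y) atTop with hL
  have hms : ∀ n, Measurable (slice s p Ω (u n)) := fun n => measurable_slice (hu n)
  have hLm : Measurable L := Measurable.liminf hms
  have hex : ∀ (k : ℕ) (y : E N), ∃ n, k ≤ n ∧ slice s p Ω (u n) y ≤ L y + (k + 1 : ℝ≥0∞)⁻¹ := by
    intro k y
    by_cases hy : L y = ∞
    · exact ⟨k, le_rfl, by simp [hy]⟩
    · have hlt : L y < L y + (k + 1 : ℝ≥0∞)⁻¹ :=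
        ENNReal.lt_add_right hy (by
          simp only [ne_eq, ENNReal.inv_eq_zero]
          exact_mod_cast ENNReal.natCast_ne_top (k + 1))
      have hf := frequently_lt_of_liminf_lt (by isBoundedDefault) hlt
      obtain ⟨n, hn, h⟩ := (frequently_atTop.1 hf) k
      exact ⟨n, hn, h.le⟩
  -- Taking the least admissible index makes the selection measurable in `y`.
  set ν : ℕ → E N → ℕ := fun k y => Nat.find (hex k y) with hν
  have hνm : ∀ k, Measurable (ν k) := by
    intro k
    refine measurable_find (hex k) fun n => ?_
    exact (MeasurableSet.const _).inter
      (measurableSet_le (hms n) (hLm.add measurable_const))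
  have hνspec : ∀ k y, k ≤ ν k y ∧
      slice s p Ω (u (ν k y)) y ≤ L y + (k + 1 : ℝ≥0∞)⁻¹ := fun k y => Nat.find_spec (hex k y)
  set t : ℕ → E N → ℝ := fun k y => u (ν k y) y with ht
  have htm : ∀ k, Measurable (t k) := fun k =>
    (measurable_from_prod_countable_right (f := fun z : ℕ × E N => u z.1 z.2) hu).comp
      ((hνm k).prodMk measurable_id)
  have hνt : ∀ y, Tendsto (fun k => ν k y) atTop atTop := fun y =>
    tendsto_atTop_mono (fun k => (hνspec k y).1) tendsto_id
  -- On `Ω` this is a.e. the limit `w`, as the indices tend to infinity. Elsewhere it is a limit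
  -- point of the selected values if `L y < ∞`; if `L y = ∞` its value is irrelevant.
  set v : E N → ℝ := fun y => limsup (fun k => t k y) atTop with hv
  have hvm : Measurable v := Measurable.limsup htm
  have hvw : v =ᵐ[volume.restrict Ω] w := by
    filter_upwards [hw] with y hy
    exact (hy.comp (hνt y)).limsup_eq
  refine ⟨v, hvm, hvw, ?_⟩
  have key : ∀ y, slice s p Ω v y ≤ L y := by
    intro y
    by_cases hy : L y = ∞
    · simp [hy]
    obtain ⟨R, hR⟩ := exists_norm_sub_le (Bornology.isBounded_singleton (x := y)) hb
    -- The selected slices are at most `L y + 1`, so `rpow_mul_volume_le` bounds the values at `y`.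
    obtain ⟨T, hT⟩ : ∃ T : ℝ, ∀ k, |t k y| ≤ T := by
      set D : ℝ≥0∞ := ENNReal.ofReal (2 ^ p) *
        (C + ENNReal.ofReal (R ^ ((N : ℝ) + p * s)) * (L y + 1)) / volume Ω with hD
      have hDfin : D ≠ ∞ := by
        refine ENNReal.div_ne_top (ENNReal.mul_ne_top ENNReal.ofReal_ne_top
          (ENNReal.add_ne_top.2 ⟨hC, ENNReal.mul_ne_top ENNReal.ofReal_ne_top ?_⟩)) h0
        exact ENNReal.add_ne_top.2 ⟨hy, ENNReal.one_ne_top⟩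
      refine ⟨D.toReal ^ (1 / p), fun k => ?_⟩
      have h1 : ENNReal.ofReal (|t k y| ^ p) ≤ D := by
        refine (ENNReal.le_div_iff_mul_le (Or.inl h0) (Or.inl hb.measure_lt_top.ne)).2 ?_
        refine (rpow_mul_volume_le hp hs hΩ (hu (ν k y)) (hR y rfl)).trans ?_
        gcongr
        · exact hl _
        · refine (hνspec k y).2.trans ?_
          gcongr
          exact ENNReal.inv_le_one.2 le_add_self
      have h2 : |t k y| ^ p ≤ D.toReal := (ENNReal.ofReal_le_iff_le_toReal hDfin).1 h1
      calc |t k y| = (|t k y| ^ p) ^ (1 / p) := by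
            rw [← Real.rpow_mul (abs_nonneg _), mul_one_div_cancel hp.ne', Real.rpow_one]
        _ ≤ _ := Real.rpow_le_rpow (by positivity) h2 (by positivity)
    have hbd : IsBoundedUnder (· ≤ ·) atTop (fun k => t k y) :=
      isBoundedUnder_of ⟨T, fun k => (abs_le.1 (hT k)).2⟩
    have hbd' : IsBoundedUnder (· ≥ ·) atTop (fun k => t k y) :=
      isBoundedUnder_of ⟨-T, fun k => (abs_le.1 (hT k)).1⟩
    obtain ⟨σ, hσ1, hσ2⟩ := exists_seq_tendsto_limsup hbd'.isCoboundedUnder_le hbd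
    have hae : ∀ᵐ x ∂(volume.restrict Ω), Tendsto
        (fun j => ENNReal.ofReal (kernel s p (u (ν (σ j) y)) (y, x))) atTop
        (𝓝 (ENNReal.ofReal (kernel s p v (y, x)))) := by
      filter_upwards [hw, hvw] with x hx hx'
      have hx2 : Tendsto (fun j => u (ν (σ j) y) x) atTop (𝓝 (v x)) := by
        rw [hx']
        exact hx.comp ((hνt y).comp hσ2)
      refine (ENNReal.continuous_ofReal.tendsto _).comp ?_
      have h3 : Tendsto (fun j => u (ν (σ j) y) y - u (ν (σ j) y) x) atTop (𝓝 (v y - v x)) :=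
        Tendsto.sub hσ1 hx2
      exact (h3.abs.rpow_const (Or.inr hp.le)).div_const _
    -- Fatou in `x` with `y` fixed, along a subsequence of the selected indices whose values at `y`
    -- converge to `v y`.
    calc slice s p Ω v y
        = ∫⁻ x in Ω, liminf (fun j => ENNReal.ofReal (kernel s p (u (ν (σ j) y)) (y, x))) atTop := by
          refine lintegral_congr_ae ?_
          filter_upwards [hae] with x hx
          exact hx.liminf_eq.symm
      _ ≤ liminf (fun j => slice s p Ω (u (ν (σ j) y)) y) atTop :=
          lintegral_liminf_le fun j =>
            ((measurable_kernel (hu _)).comp measurable_prodMk_left).ennreal_ofReal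
      _ ≤ liminf (fun j => L y + ((σ j : ℝ≥0∞) + 1)⁻¹) atTop :=
          liminf_le_liminf (Eventually.of_forall fun j => (hνspec (σ j) y).2)
      _ = L y := by
          have h4 : Tendsto (fun k : ℕ => L y + ((k : ℝ≥0∞) + 1)⁻¹) atTop (𝓝 (L y + 0)) := by
            refine tendsto_const_nhds.add ?_
            have := (tendsto_add_atTop_iff_nat 1).2 ENNReal.tendsto_inv_nat_nhds_zero
            simpa using this
          rw [add_zero] at h4
          exact (h4.comp hσ2).liminf_eq
  rw [gagl_eq_slice hΩ hvm]
  calc ∫⁻ y, slice s p Ω v y ∂(volume + volume.restrict Ωᶜ)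
      ≤ ∫⁻ y, L y ∂(volume + volume.restrict Ωᶜ) := lintegral_mono key
    _ ≤ liminf (fun n => ∫⁻ y, slice s p Ω (u n) y ∂(volume + volume.restrict Ωᶜ)) atTop :=
        lintegral_liminf_le hms
    _ = _ := by simp_rw [gagl_eq_slice hΩ (hu _)]

/-! ### Compactness in $L^p(\Omega)$ through averages over cubes. -/

lemma lpPow_eq_eLpNorm (hp : 0 < p) (u : E N → ℝ) :
    eLpNorm u (ENNReal.ofReal p) (volume.restrict Ω) = lpPow p Ω u ^ (1 / p) := by
  rw [eLpNorm_eq_lintegral_rpow_enorm_toReal (by simpa using hp) ENNReal.ofReal_ne_top,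
    ENNReal.toReal_ofReal hp.le]
  congr 1
  refine lintegral_congr fun x => ?_
  rw [Real.enorm_eq_ofReal_abs, ENNReal.ofReal_rpow_of_nonneg (abs_nonneg _) hp.le]

/-- The index of the cube of side `1 / (j + 1)` containing a point. -/
def cubeIndex (j : ℕ) (y : E N) : Fin N → ℤ := fun i => ⌊((j : ℝ) + 1) * y i⌋

/-- The cube of side `1 / (j + 1)` with index `k`. -/
def cube (j : ℕ) (k : Fin N → ℤ) : Set (E N) := cubeIndex j ⁻¹' {k}

lemma measurable_cubeIndex (j : ℕ) : Measurable (cubeIndex (N := N) j) := by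
  refine measurable_pi_iff.2 fun i => Int.measurable_floor.comp ?_
  have : Measurable fun y : E N => y i :=
    (measurable_pi_apply i).comp (MeasurableEquiv.toLp 2 (Fin N → ℝ)).symm.measurable
  exact this.const_mul _

lemma measurableSet_cube (j : ℕ) (k : Fin N → ℤ) : MeasurableSet (cube (N := N) j k) :=
  measurable_cubeIndex j (measurableSet_singleton k)

lemma volume_cube (j : ℕ) (k : Fin N → ℤ) :
    volume (cube (N := N) j k) = ENNReal.ofReal (((j : ℝ) + 1)⁻¹) ^ N := by
  have hj : (0 : ℝ) < (j : ℝ) + 1 := by positivity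
  have hpre : cube (N := N) j k = (MeasurableEquiv.toLp 2 (Fin N → ℝ)).symm ⁻¹'
      (Set.pi univ fun i => Ico ((k i : ℝ) / (j + 1)) (((k i : ℝ) + 1) / (j + 1))) := by
    ext y
    simp only [cube, mem_preimage, mem_singleton_iff, funext_iff, cubeIndex, Set.mem_pi, mem_univ,
      true_imp_iff, mem_Ico, Int.floor_eq_iff]
    refine forall_congr' fun i => ?_
    rw [div_le_iff₀ hj, lt_div_iff₀ hj, mul_comm]
    rfl
  rw [hpre, (EuclideanSpace.volume_preserving_symm_measurableEquiv_toLp (Fin N)).measure_preimage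
    (MeasurableSet.univ_pi fun i => measurableSet_Ico).nullMeasurableSet, Real.volume_pi_Ico]
  have : ∀ i, ((k i : ℝ) + 1) / (j + 1) - (k i : ℝ) / (j + 1) = ((j : ℝ) + 1)⁻¹ := by
    intro i; field_simp; ring
  simp [this]

lemma norm_sub_le_of_cubeIndex_eq {j : ℕ} {x y : E N} (h : cubeIndex j x = cubeIndex j y) :
    ‖x - y‖ ≤ N * ((j : ℝ) + 1)⁻¹ := by
  have hj : (0 : ℝ) < (j : ℝ) + 1 := by positivity
  have hi : ∀ i, |x i - y i| ≤ ((j : ℝ) + 1)⁻¹ := by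
    intro i
    have h1 := Int.abs_sub_lt_one_of_floor_eq_floor (congrFun h i)
    rw [← mul_sub, abs_mul, abs_of_pos hj] at h1
    rw [← one_div, le_div_iff₀ hj]
    linarith
  rw [EuclideanSpace.norm_eq]
  refine Real.sqrt_le_iff.2 ⟨by positivity, ?_⟩
  calc ∑ i, ‖(x - y) i‖ ^ 2 ≤ ∑ _i : Fin N, (((j : ℝ) + 1)⁻¹) ^ 2 := by
        refine Finset.sum_le_sum fun i _ => ?_
        rw [Real.norm_eq_abs]
        exact pow_le_pow_left₀ (abs_nonneg _) (hi i) 2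
    _ = N * (((j : ℝ) + 1)⁻¹) ^ 2 := by simp
    -- The crude factor `N` in place of $\sqrt N$ suffices for the diameter.
    _ ≤ (N : ℝ) ^ 2 * (((j : ℝ) + 1)⁻¹) ^ 2 := by
        gcongr
        exact_mod_cast Nat.le_self_pow two_ne_zero N
    _ = _ := by ring

lemma isBounded_cube (j : ℕ) (k : Fin N → ℤ) : Bornology.IsBounded (cube (N := N) j k) := by
  refine Metric.isBounded_iff.2 ⟨N * ((j : ℝ) + 1)⁻¹, fun x hx y hy => ?_⟩
  rw [dist_eq_norm]
  exact norm_sub_le_of_cubeIndex_eq (Eq.trans hx (Eq.symm hy))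

lemma finite_image_cubeIndex (hb : Bornology.IsBounded Ω) (j : ℕ) :
    (cubeIndex j '' Ω).Finite := by
  obtain ⟨R, hR⟩ := hb.exists_norm_le
  refine (Set.finite_Icc (fun _ : Fin N => ⌊-(((j : ℝ) + 1) * R)⌋)
    (fun _ : Fin N => ⌊((j : ℝ) + 1) * R⌋)).subset ?_
  rintro _ ⟨x, hx, rfl⟩
  have hj : (0 : ℝ) < (j : ℝ) + 1 := by positivity
  have hi : ∀ i, |x i| ≤ R := fun i => (PiLp.norm_apply_le x i).trans (hR x hx)
  refine ⟨fun i => Int.floor_le_floor ?_, fun i => Int.floor_le_floor ?_⟩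
  · have := (abs_le.1 (hi i)).1
    nlinarith
  · exact mul_le_mul_of_nonneg_left (abs_le.1 (hi i)).2 hj.le

/-- Normalised Lebesgue measure on a cube. -/
def cubeMeasure (j : ℕ) (k : Fin N → ℤ) : Measure (E N) :=
  (volume (cube (N := N) j k))⁻¹ • volume.restrict (cube j k)

lemma volume_cube_ne_zero (j : ℕ) (k : Fin N → ℤ) : volume (cube (N := N) j k) ≠ 0 := by
  rw [volume_cube]
  exact pow_ne_zero _ (by simp; positivity)

lemma volume_cube_ne_top (j : ℕ) (k : Fin N → ℤ) : volume (cube (N := N) j k) ≠ ∞ := by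
  rw [volume_cube]
  exact ENNReal.pow_ne_top ENNReal.ofReal_ne_top

instance (j : ℕ) (k : Fin N → ℤ) : IsProbabilityMeasure (cubeMeasure (N := N) j k) :=
  ⟨by simp [cubeMeasure, ENNReal.inv_mul_cancel (volume_cube_ne_zero j k)
    (volume_cube_ne_top j k)]⟩

/-- Jensen's inequality, from the monotonicity of $L^q$ norms in $q$ on a probability space. -/
lemma enorm_integral_rpow_le {α : Type*} [MeasurableSpace α] {μ : Measure α}
    [IsProbabilityMeasure μ] (hp : 1 ≤ p) {f : α → ℝ} (hf : AEStronglyMeasurable f μ) :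
    ENNReal.ofReal (|∫ x, f x ∂μ| ^ p) ≤ ∫⁻ x, ENNReal.ofReal (|f x| ^ p) ∂μ := by
  have hp0 : 0 < p := by linarith
  have h1 : ‖∫ x, f x ∂μ‖ₑ ≤ (∫⁻ x, ‖f x‖ₑ ^ p ∂μ) ^ (1 / p) := by
    calc ‖∫ x, f x ∂μ‖ₑ ≤ eLpNorm f 1 μ := by
          rw [eLpNorm_one_eq_lintegral_enorm]
          exact enorm_integral_le_lintegral_enorm f
      _ ≤ eLpNorm f (ENNReal.ofReal p) μ :=
          eLpNorm_le_eLpNorm_of_exponent_le (by simpa using hp) hf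
      _ = _ := by
          rw [eLpNorm_eq_lintegral_rpow_enorm_toReal (by simpa using hp0) ENNReal.ofReal_ne_top,
            ENNReal.toReal_ofReal hp0.le]
  simp_rw [← ENNReal.ofReal_rpow_of_nonneg (abs_nonneg _) hp0.le, ← Real.enorm_eq_ofReal_abs]
  rw [one_div] at h1
  exact (ENNReal.le_rpow_inv_iff hp0).1 h1

/-- The average of `u` over a cube. -/
def cubeAverage (u : E N → ℝ) (j : ℕ) (k : Fin N → ℤ) : ℝ := ∫ y, u y ∂(cubeMeasure j k)

lemma integrable_cubeMeasure (hp : 1 ≤ p) {u : E N → ℝ} (hu : Measurable u) {j : ℕ}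
    {k : Fin N → ℤ} (h : ∫⁻ y in cube j k, ENNReal.ofReal (|u y| ^ p) ≠ ∞) :
    Integrable u (cubeMeasure j k) := by
  have hp0 : 0 < p := by linarith
  have hm : MemLp u (ENNReal.ofReal p) (cubeMeasure j k) := by
    refine MemLp.smul_measure (μ := volume.restrict (cube j k))
      ⟨hu.aestronglyMeasurable, ?_⟩ (ENNReal.inv_ne_top.2 (volume_cube_ne_zero j k))
    have := lpPow_eq_eLpNorm (Ω := cube j k) hp0 u
    rw [this]
    exact ENNReal.rpow_lt_top_of_nonneg (by positivity) h
  exact hm.integrable (by simpa using hp)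

/-- The deviation from the average is the average of $u(x)-u(y)$ over the cube of `x`; Jensen and
`diff_rpow_le` at the scale of the cube give the two factors. -/
lemma sub_cubeAverage_rpow_le (hp : 1 ≤ p) (hs : 0 < s) {u : E N → ℝ} (hu : Measurable u) {j : ℕ}
    (x : E N) (h : ∫⁻ y in cube j (cubeIndex j x), ENNReal.ofReal (|u y| ^ p) ≠ ∞) :
    ENNReal.ofReal (|u x - cubeAverage u j (cubeIndex j x)| ^ p) ≤
      (ENNReal.ofReal (((j : ℝ) + 1)⁻¹) ^ N)⁻¹ *
        (ENNReal.ofReal ((N * ((j : ℝ) + 1)⁻¹) ^ ((N : ℝ) + p * s)) *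
          ∫⁻ y, ENNReal.ofReal (kernel s p u (x, y))) := by
  have hp0 : 0 < p := by linarith
  set k := cubeIndex j x
  have hint := integrable_cubeMeasure hp hu h
  have h1 : u x - cubeAverage u j k = ∫ y, (u x - u y) ∂(cubeMeasure j k) := by
    rw [integral_sub (integrable_const _) hint]
    simp [cubeAverage]
  rw [h1]
  refine (enorm_integral_rpow_le hp (measurable_const.sub hu).aestronglyMeasurable).trans ?_
  rw [cubeMeasure, lintegral_smul_measure, volume_cube, smul_eq_mul]
  gcongr
  rw [← lintegral_const_mul' _ _ ENNReal.ofReal_ne_top]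
  refine (setLIntegral_mono' (measurableSet_cube j k) fun y hy => ?_).trans
    (setLIntegral_le_lintegral _ _)
  rw [← ENNReal.ofReal_mul (by positivity)]
  refine ENNReal.ofReal_le_ofReal (diff_rpow_le hp0 hs u ?_)
  exact norm_sub_le_of_cubeIndex_eq (Eq.symm hy)

/-- This is where $\Omega\times\mathbb R^N\subseteq\mathcal Q$ enters: cubes that cross the boundary
of `Ω` are still controlled. -/
lemma setLIntegral_lintegral_kernel_le {u : E N → ℝ} (hu : Measurable u) :
    ∫⁻ x in Ω, ∫⁻ y, ENNReal.ofReal (kernel s p u (x, y)) ≤ gagl s p Ω u := by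
  have hsub : Ω ×ˢ (univ : Set (E N)) ⊆ Q Ω := fun z hz h => h.1 hz.1
  refine le_trans (le_of_eq ?_) (lintegral_mono_set hsub)
  rw [Measure.volume_eq_prod, setLIntegral_prod _
    (measurable_kernel hu).ennreal_ofReal.aemeasurable, Measure.restrict_univ]

/-- The rate at which cube averages approximate functions of unit Gagliardo energy. -/
def cubeRate (N : ℕ) (s p : ℝ) (j : ℕ) : ℝ≥0∞ :=
  (ENNReal.ofReal (((j : ℝ) + 1)⁻¹) ^ N)⁻¹ *
    ENNReal.ofReal ((N * ((j : ℝ) + 1)⁻¹) ^ ((N : ℝ) + p * s))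

lemma lpPow_sub_cubeAverage_le (hp : 1 ≤ p) (hs : 0 < s) (hΩ : MeasurableSet Ω)
    {u : E N → ℝ} (hu : Measurable u) (j : ℕ)
    (h : ∀ k, ∫⁻ y in cube j k, ENNReal.ofReal (|u y| ^ p) ≠ ∞) :
    lpPow p Ω (fun x => u x - cubeAverage u j (cubeIndex j x)) ≤
      cubeRate N s p j * gagl s p Ω u := by
  unfold cubeRate
  have hfin : (ENNReal.ofReal (((j : ℝ) + 1)⁻¹) ^ N)⁻¹ *
    ENNReal.ofReal ((N * ((j : ℝ) + 1)⁻¹) ^ ((N : ℝ) + p * s)) ≠ ∞ := by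
    refine ENNReal.mul_ne_top (ENNReal.inv_ne_top.2 (pow_ne_zero _ ?_)) ENNReal.ofReal_ne_top
    simp; positivity
  refine le_trans ?_ (mul_le_mul_right (setLIntegral_lintegral_kernel_le hu) _)
  rw [← lintegral_const_mul' _ _ hfin]
  refine setLIntegral_mono' hΩ fun x _ => ?_
  rw [mul_assoc]
  exact sub_cubeAverage_rpow_le hp hs hu x (h _)

/-- The normalisation $(j+1)^N$ cancels against the exponent $N+ps$ of the diameter and leaves a
multiple of $(j+1)^{-ps}$. -/
lemma tendsto_cubeRate (hp : 0 < p) (hs : 0 < s) : Tendsto (cubeRate N s p) atTop (𝓝 0) := by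
  have hps : 0 < p * s := by positivity
  have h1 : ∀ j, cubeRate N s p j = ENNReal.ofReal
      ((N : ℝ) ^ ((N : ℝ) + p * s) * (((j : ℝ) + 1)⁻¹) ^ (p * s)) := by
    intro j
    have hj : (0 : ℝ) < ((j : ℝ) + 1)⁻¹ := by positivity
    rw [cubeRate, ← ENNReal.ofReal_pow hj.le, ← ENNReal.ofReal_inv_of_pos (by positivity),
      ← ENNReal.ofReal_mul (by positivity)]
    congr 1
    rw [Real.mul_rpow (by positivity) hj.le, Real.rpow_add hj, Real.rpow_natCast]
    field_simp
  have h2 : Tendsto (fun j : ℕ => ((j : ℝ) + 1)⁻¹) atTop (𝓝 0) := by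
    simpa [one_div] using tendsto_one_div_add_atTop_nhds_zero_nat (𝕜 := ℝ)
  have h3 := (h2.rpow_const (p := p * s) (Or.inr hps.le)).const_mul
    ((N : ℝ) ^ ((N : ℝ) + p * s))
  rw [Real.zero_rpow hps.ne', mul_zero] at h3
  have h4 := (ENNReal.continuous_ofReal.tendsto 0).comp h3
  rw [ENNReal.ofReal_zero] at h4
  exact h4.congr fun j => (h1 j).symm

/-- Bounded sequences in `X` have subsequences along which all cube averages converge. -/
lemma exists_subseq_cubeAverage (hp : 1 ≤ p) (hs : 0 < s) (hΩ : MeasurableSet Ω)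
    (hb : Bornology.IsBounded Ω) (h0 : volume Ω ≠ 0) {u : ℕ → E N → ℝ}
    (hu : ∀ n, Measurable (u n)) {C : ℝ≥0∞} (hC : C ≠ ∞) (hl : ∀ n, lpPow p Ω (u n) ≤ C)
    (hg : ∀ n, gagl s p Ω (u n) ≤ C) :
    ∃ (φ : ℕ → ℕ) (α : ℕ × (Fin N → ℤ) → ℝ), StrictMono φ ∧
      ∀ j k, Tendsto (fun n => cubeAverage (u (φ n)) j k) atTop (𝓝 (α (j, k))) := by
  have hp0 : 0 < p := by linarith
  have hbd : ∀ i : ℕ × (Fin N → ℤ), ∃ T : ℝ, ∀ n, |cubeAverage (u n) i.1 i.2| ≤ T := by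
    rintro ⟨j, k⟩
    obtain ⟨K, hK, hKb⟩ := exists_local_bound hp0 hs hΩ hb h0 (isBounded_cube j k)
    set D : ℝ≥0∞ := (volume (cube (N := N) j k))⁻¹ * (K * C) with hD
    have hDfin : D ≠ ∞ := ENNReal.mul_ne_top (ENNReal.inv_ne_top.2 (volume_cube_ne_zero j k))
      (ENNReal.mul_ne_top hK hC)
    refine ⟨D.toReal ^ (1 / p), fun n => ?_⟩
    have h1 : ENNReal.ofReal (|cubeAverage (u n) j k| ^ p) ≤ D := by
      refine (enorm_integral_rpow_le hp (hu n).aestronglyMeasurable).trans ?_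
      rw [cubeMeasure, lintegral_smul_measure, smul_eq_mul, hD]
      gcongr
      exact hKb (u n) (hu n) C (hl n) (hg n)
    have h2 := (ENNReal.ofReal_le_iff_le_toReal hDfin).1 h1
    calc |cubeAverage (u n) j k| = (|cubeAverage (u n) j k| ^ p) ^ (1 / p) := by
          rw [← Real.rpow_mul (abs_nonneg _), mul_one_div_cancel hp0.ne', Real.rpow_one]
      _ ≤ _ := Real.rpow_le_rpow (by positivity) h2 (by positivity)
  choose T hT using hbd
  -- Tychonoff's theorem over the countable set of all cubes of all sizes replaces a diagonal
  -- argument.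
  have hcomp : IsCompact (Set.pi univ fun i : ℕ × (Fin N → ℤ) => Icc (-T i) (T i)) :=
    isCompact_univ_pi fun i => isCompact_Icc
  set a : ℕ → ℕ × (Fin N → ℤ) → ℝ := fun n i => cubeAverage (u n) i.1 i.2 with ha
  have hmem : ∀ n, a n ∈ Set.pi univ fun i : ℕ × (Fin N → ℤ) => Icc (-T i) (T i) :=
    fun n i _ => abs_le.1 (hT i n)
  obtain ⟨α, -, φ, hφ, hlim⟩ := hcomp.tendsto_subseq hmem
  refine ⟨φ, α, hφ, fun j k => ?_⟩
  have h1 := (tendsto_pi_nhds.1 hlim) (j, k)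
  exact h1

/-- Compactness of the embedding of `X` into `L^p(Ω)`. -/
lemma exists_subseq_tendsto (hp : 1 ≤ p) (hs : 0 < s) (hΩ : MeasurableSet Ω)
    (hb : Bornology.IsBounded Ω) (h0 : volume Ω ≠ 0) {u : ℕ → E N → ℝ}
    (hu : ∀ n, Measurable (u n)) {C : ℝ≥0∞} (hC : C ≠ ∞) (hl : ∀ n, lpPow p Ω (u n) ≤ C)
    (hg : ∀ n, gagl s p Ω (u n) ≤ C) :
    ∃ (φ : ℕ → ℕ) (w : E N → ℝ), StrictMono φ ∧ AEMeasurable w (volume.restrict Ω) ∧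
      lpPow p Ω w ≠ ∞ ∧
      Tendsto (fun n => lpPow p Ω (u (φ n))) atTop (𝓝 (lpPow p Ω w)) ∧
      ∀ᵐ x ∂(volume.restrict Ω), Tendsto (fun n => u (φ n) x) atTop (𝓝 (w x)) := by
  have hp0 : 0 < p := by linarith
  set μ := (volume : Measure (E N)).restrict Ω with hμ
  set P := ENNReal.ofReal p with hP
  have hP1 : 1 ≤ P := by simpa [hP] using hp
  have : Fact (1 ≤ P) := ⟨hP1⟩
  have : IsFiniteMeasure μ := ⟨by simpa [hμ] using hb.measure_lt_top⟩
  obtain ⟨φ, α, hφ, hα⟩ := exists_subseq_cubeAverage hp hs hΩ hb h0 hu hC hl hg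
  have hmem : ∀ n, MemLp (u n) P μ := fun n => ⟨(hu n).aestronglyMeasurable, by
    rw [lpPow_eq_eLpNorm hp0]
    exact ENNReal.rpow_lt_top_of_nonneg (by positivity) ((hl n).trans_lt hC.lt_top).ne⟩
  have hstep : ∀ β : ℕ × (Fin N → ℤ) → ℝ, ∀ j : ℕ,
      Measurable fun x : E N => β (j, cubeIndex j x) := fun β j =>
    (measurable_of_countable β).comp (measurable_const.prodMk (measurable_cubeIndex j))
  have hloc : ∀ n j k, ∫⁻ y in cube j k, ENNReal.ofReal (|u n y| ^ p) ≠ ∞ := by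
    intro n j k
    obtain ⟨K, hK, hKb⟩ := exists_local_bound hp0 hs hΩ hb h0 (isBounded_cube j k)
    exact ((hKb (u n) (hu n) C (hl n) (hg n)).trans_lt (ENNReal.mul_lt_top hK.lt_top
      hC.lt_top)).ne
  have happrox : ∀ n j, eLpNorm (fun x => u n x - cubeAverage (u n) j (cubeIndex j x)) P μ ≤
      (cubeRate N s p j * C) ^ (1 / p) := by
    intro n j
    rw [lpPow_eq_eLpNorm hp0]
    refine ENNReal.rpow_le_rpow ?_ (by positivity)
    refine (lpPow_sub_cubeAverage_le hp hs hΩ (hu n) j (hloc n j)).trans ?_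
    gcongr
    exact hg n
  have havg : ∀ j, Tendsto (fun n => eLpNorm (fun x =>
      cubeAverage (u (φ n)) j (cubeIndex j x) - α (j, cubeIndex j x)) P μ) atTop (𝓝 0) := by
    intro j
    -- Only finitely many cubes of a given size meet `Ω`, so convergence of the averages is uniform
    -- on `Ω`.
    set S := (finite_image_cubeIndex hb j).toFinset
    set δ : ℕ → ℝ := fun n => ∑ k ∈ S, |cubeAverage (u (φ n)) j k - α (j, k)|
    have hδ : Tendsto δ atTop (𝓝 0) := by
      have : Tendsto δ atTop (𝓝 (∑ k ∈ S, (0 : ℝ))) := by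
        refine tendsto_finsetSum _ fun k _ => ?_
        have := ((hα j k).sub_const (α (j, k))).abs
        simpa using this
      simpa using this
    have hle : ∀ n, eLpNorm (fun x =>
        cubeAverage (u (φ n)) j (cubeIndex j x) - α (j, cubeIndex j x)) P μ ≤
          μ univ ^ P.toReal⁻¹ * ENNReal.ofReal (δ n) := by
      intro n
      refine eLpNorm_le_of_ae_bound ?_
      refine ae_restrict_of_forall_mem hΩ fun x hx => ?_
      rw [Real.norm_eq_abs]
      exact Finset.single_le_sum (f := fun k => |cubeAverage (u (φ n)) j k - α (j, k)|)
        (fun k _ => abs_nonneg _)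
        ((finite_image_cubeIndex hb j).mem_toFinset.2 (mem_image_of_mem _ hx))
    refine tendsto_of_tendsto_of_tendsto_of_le_of_le tendsto_const_nhds ?_
      (fun _ => zero_le) hle
    have h1 := (ENNReal.continuous_ofReal.tendsto 0).comp hδ
    rw [ENNReal.ofReal_zero] at h1
    have h2 := ENNReal.Tendsto.const_mul (a := μ univ ^ P.toReal⁻¹) h1
      (Or.inr (ENNReal.rpow_ne_top_of_nonneg (by positivity) (measure_ne_top μ univ)))
    simpa using h2
  have hrate : Tendsto (fun j => (cubeRate N s p j * C) ^ (1 / p)) atTop (𝓝 0) := by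
    have h1 := ENNReal.Tendsto.mul_const (tendsto_cubeRate (N := N) hp0 hs)
      (b := C) (Or.inr hC)
    have h2 := (ENNReal.continuous_rpow_const (y := 1 / p)).tendsto (0 * C) |>.comp h1
    simpa [hp0, Function.comp_def] using h2
  set f : ℕ → Lp ℝ P μ := fun n => (hmem (φ n)).toLp with hf
  have hcauchy : CauchySeq f := by
    refine EMetric.cauchySeq_iff.2 fun ε hε => ?_
    have hε4 : 0 < ε / 4 := ENNReal.div_pos hε.ne' (by norm_num)
    -- The cube size is fixed before `n₀`; this is possible because the rate is uniform in `n`.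
    obtain ⟨j, hj⟩ := (hrate.eventually (gt_mem_nhds hε4)).exists
    obtain ⟨n₀, hn₀⟩ := eventually_atTop.1 ((havg j).eventually (gt_mem_nhds hε4))
    have hnear : ∀ n ≥ n₀, eLpNorm (fun x => u (φ n) x - α (j, cubeIndex j x)) P μ < ε / 2 := by
      intro n hn
      have hsum : (fun x => u (φ n) x - α (j, cubeIndex j x)) =
          (fun x => u (φ n) x - cubeAverage (u (φ n)) j (cubeIndex j x)) +
          (fun x => cubeAverage (u (φ n)) j (cubeIndex j x) - α (j, cubeIndex j x)) := by
        funext x; simp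
      have hm1 := hstep (fun z => cubeAverage (u (φ n)) z.1 z.2) j
      have hm2 := hstep α j
      rw [hsum]
      refine (eLpNorm_add_le ((hu _).sub hm1).aestronglyMeasurable
        (hm1.sub hm2).aestronglyMeasurable hP1).trans_lt ?_
      calc _ < ε / 4 + ε / 4 := ENNReal.add_lt_add ((happrox _ j).trans_lt hj) (hn₀ n hn)
        _ = ε / 2 := by
          rw [← two_mul, show (4 : ℝ≥0∞) = 2 * 2 by norm_num, ← mul_div_assoc,
            ENNReal.mul_div_mul_left _ _ two_ne_zero ENNReal.ofNat_ne_top]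
    refine ⟨n₀, fun m hm n hn => ?_⟩
    rw [hf, Lp.edist_toLp_toLp]
    have hsum : u (φ m) - u (φ n) = (fun x => u (φ m) x - α (j, cubeIndex j x)) -
        (fun x => u (φ n) x - α (j, cubeIndex j x)) := by
      funext x; simp
    have hm2 := hstep α j
    rw [hsum]
    refine (eLpNorm_sub_le ((hu _).sub hm2).aestronglyMeasurable
      ((hu _).sub hm2).aestronglyMeasurable hP1).trans_lt ?_
    calc _ < ε / 2 + ε / 2 := ENNReal.add_lt_add (hnear m hm) (hnear n hn)
      _ = ε := ENNReal.add_halves ε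
  obtain ⟨w, hw⟩ := cauchySeq_tendsto_of_complete hcauchy
  have hLp : Tendsto (fun n => eLpNorm (u (φ n) - (w : E N → ℝ)) P μ) atTop (𝓝 0) := by
    refine ((Lp.tendsto_Lp_iff_tendsto_eLpNorm' f w).1 hw).congr fun n => ?_
    refine eLpNorm_congr_ae ?_
    filter_upwards [(hmem (φ n)).coeFn_toLp] with x hx
    simp [hf, hx]
  obtain ⟨ψ, hψ, hae⟩ := (tendstoInMeasure_of_tendsto_eLpNorm (by simpa [hP] using hp0)
    (fun n => (hu (φ n)).aestronglyMeasurable) (Lp.aestronglyMeasurable w)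
    hLp).exists_seq_tendsto_ae
  have hpow : ∀ v : E N → ℝ, lpPow p Ω v = eLpNorm v P μ ^ p := by
    intro v
    rw [lpPow_eq_eLpNorm hp0, ← ENNReal.rpow_mul, one_div_mul_cancel hp0.ne', ENNReal.rpow_one]
  have hwfin := Lp.eLpNorm_ne_top w
  refine ⟨φ ∘ ψ, w, hφ.comp hψ, (Lp.aestronglyMeasurable w).aemeasurable, ?_, ?_, hae⟩
  · rw [hpow]
    exact ENNReal.rpow_ne_top_of_nonneg hp0.le hwfin
  · have hnorm : Tendsto (fun n => eLpNorm (f n) P μ) atTop (𝓝 (eLpNorm w P μ)) := by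
      have h1 := (ENNReal.continuous_ofReal.tendsto _).comp hw.norm
      simp only [Lp.norm_def, Function.comp_def, ENNReal.ofReal_toReal (Lp.eLpNorm_ne_top _)] at h1
      exact h1
    have hnorm' : Tendsto (fun n => eLpNorm (u (φ n)) P μ) atTop (𝓝 (eLpNorm w P μ)) :=
      hnorm.congr fun n => eLpNorm_congr_ae (hmem (φ n)).coeFn_toLp
    simp_rw [hpow]
    exact ((ENNReal.continuous_rpow_const (y := p)).tendsto _).comp
      (hnorm'.comp hψ.tendsto_atTop)

/-! ### Carathéodory functions, growth, and primitives. -/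

/-- A Carathéodory function agrees a.e. with one that is measurable in the first variable and
everywhere continuous in the second. -/
lemma IsCaratheodory.exists_regular (hg : IsCaratheodory Ω g) :
    ∃ h : ℝ → E N → ℝ, (∀ x, Continuous fun t => h t x) ∧ (∀ t, Measurable (h t)) ∧
      ∀ᵐ x ∂(volume.restrict Ω), ∀ t, g x t = h t x := by
  classical
  set μ := (volume : Measure (E N)).restrict Ω
  have hae : ∀ᵐ x ∂μ, Continuous (g x) ∧ ∀ q : ℚ, g x q = (hg.measurable q).mk _ x := by
    filter_upwards [hg.continuous, ae_all_iff.2 fun q : ℚ => (hg.measurable q).ae_eq_mk] with x h1 h2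
    exact ⟨h1, h2⟩
  -- One measurable null set for all rational `t`. Off it `g` is kept, on it replaced by `0`;
  -- measurability at real `t` follows by rational approximation.
  set Z := toMeasurable μ {x | ¬(Continuous (g x) ∧ ∀ q : ℚ, g x q = (hg.measurable q).mk _ x)}
    with hZ
  have hZm : MeasurableSet Z := measurableSet_toMeasurable _ _
  have hZ0 : μ Z = 0 := by rw [hZ, measure_toMeasurable]; exact hae
  have hgood : ∀ x ∉ Z, Continuous (g x) ∧ ∀ q : ℚ, g x q = (hg.measurable q).mk _ x := by
    intro x hx
    by_contra h
    exact hx (subset_toMeasurable μ _ h)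
  set h : ℝ → E N → ℝ := fun t => Zᶜ.indicator fun x => g x t with hh
  have hcont : ∀ x, Continuous fun t => h t x := by
    intro x
    by_cases hx : x ∈ Z
    · simp [hh, hx, continuous_const]
    · simpa [hh, hx] using (hgood x hx).1
  have hq : ∀ q : ℚ, Measurable (h q) := by
    intro q
    have : h q = Zᶜ.indicator ((hg.measurable q).mk _) := by
      refine indicator_congr fun x hx => (hgood x hx).2 q
    rw [this]
    exact (hg.measurable q).measurable_mk.indicator hZm.compl
  refine ⟨h, hcont, fun t => ?_, ?_⟩
  · obtain ⟨r, hr⟩ := mem_closure_iff_seq_limit.1 ((Rat.denseRange_cast (𝕜 := ℝ)) t)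
    choose q hq' using hr.1
    refine measurable_of_tendsto_metrizable (fun n => hq (q n)) (tendsto_pi_nhds.2 fun x => ?_)
    have h1 : Tendsto (fun n => ((q n : ℚ) : ℝ)) atTop (𝓝 t) := by simpa [hq'] using hr.2
    exact ((hcont x).tendsto t).comp h1
  · have : ∀ᵐ x ∂μ, x ∉ Z := measure_eq_zero_iff_ae_notMem.1 hZ0
    filter_upwards [this] with x hx t
    simp [hh, hx]

lemma IsCaratheodory.aemeasurable_comp (hg : IsCaratheodory Ω g) {u : E N → ℝ}
    (hu : AEMeasurable u (volume.restrict Ω)) :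
    AEMeasurable (fun x => g x (u x)) (volume.restrict Ω) := by
  obtain ⟨h, h1, h2, h3⟩ := hg.exists_regular
  refine ((measurable_uncurry_of_continuous_of_measurable h1 h2).comp_aemeasurable
    (hu.prodMk aemeasurable_id)).congr ?_
  filter_upwards [h3] with x hx
  simp [hx]

/-- The primitive of a regular representative is again measurable in `x` and continuous in `t`,
hence jointly measurable. -/
lemma IsCaratheodory.aemeasurable_primitive (hg : IsCaratheodory Ω g) {u : E N → ℝ}
    (hu : AEMeasurable u (volume.restrict Ω)) :
    AEMeasurable (fun x => primitive g x (u x)) (volume.restrict Ω) := by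
  obtain ⟨h, h1, h2, h3⟩ := hg.exists_regular
  have hj := measurable_uncurry_of_continuous_of_measurable h1 h2
  have hj' : StronglyMeasurable fun z : E N × ℝ => h z.2 z.1 :=
    (hj.comp measurable_swap).stronglyMeasurable
  set H : ℝ → E N → ℝ := fun t x => ∫ τ in (0 : ℝ)..t, h τ x with hH
  have hHm : ∀ t, Measurable (H t) := by
    intro t
    refine Measurable.sub ?_ ?_
    · exact (hj'.integral_prod_right' (ν := volume.restrict (Ioc 0 t))).measurable
    · exact (hj'.integral_prod_right' (ν := volume.restrict (Ioc t 0))).measurable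
  have hHc : ∀ x, Continuous fun t => H t x := fun x =>
    intervalIntegral.continuous_primitive (fun a b => (h1 x).intervalIntegrable a b) 0
  refine ((measurable_uncurry_of_continuous_of_measurable hHc hHm).comp_aemeasurable
    (hu.prodMk aemeasurable_id)).congr ?_
  filter_upwards [h3] with x hx
  simp [hH, primitive, hx]

/-- The growth condition in the form in which it is used: a bound by an integrable function and a
`p`-th power. -/
lemma HasPLinearGrowth.exists_bound (hp : 1 < p) (hgr : HasPLinearGrowth p Ω g)
    (hg : IsCaratheodory Ω g) :
    ∃ (A : E N → ℝ) (B : ℝ), IntegrableOn A Ω ∧ (∀ x, 0 ≤ A x) ∧ 0 ≤ B ∧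
      ∀ᵐ x ∂(volume.restrict Ω), ∀ t r, |g x t| * |r| ≤ A x + B * (|t| + |r|) ^ p := by
  obtain ⟨a, b, ha, hab⟩ := hgr
  set q := p / (p - 1) with hq
  have hp0 : 0 < p := by linarith
  have hp1 : 0 < p - 1 := by linarith
  have hq0 : 0 < q := div_pos hp0 hp1
  have hconj : q.HolderConjugate p := (Real.HolderConjugate.conjExponent hp).symm
  -- The exceptional set may depend on `t`; rational `t` and continuity yield a common one.
  have hall : ∀ᵐ x ∂(volume.restrict Ω), ∀ t, |g x t| ≤ a x + b * |t| ^ (p - 1) := by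
    filter_upwards [hg.continuous, ae_all_iff.2 fun r : ℚ => hab r] with x hc hx
    have hcl : IsClosed {t : ℝ | |g x t| ≤ a x + b * |t| ^ (p - 1)} :=
      isClosed_le hc.abs (continuous_const.add (continuous_const.mul
        (continuous_abs.rpow_const fun _ => Or.inr hp1.le)))
    intro t
    exact Rat.denseRange_cast.induction_on (p := fun t => |g x t| ≤ a x + b * |t| ^ (p - 1)) t hcl hx
  -- Young's inequality for `|a x| * |r|` gives `|a x| ^ q` and the `1`; the power term gives `|b|`.
  -- The free `r` serves both the primitive and directional derivatives.
  refine ⟨fun x => |a x| ^ q, |b| + 1, ?_, fun x => by positivity, by positivity, ?_⟩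
  · have := ha.integrable_norm_rpow (by simpa using hq0) ENNReal.ofReal_ne_top
    rw [ENNReal.toReal_ofReal hq0.le] at this
    exact this
  · filter_upwards [hall] with x hx t r
    have hm : 0 ≤ |t| + |r| := by positivity
    have h1 : |a x| * |r| ≤ |a x| ^ q + (|t| + |r|) ^ p := by
      refine (Real.young_inequality_of_nonneg (abs_nonneg _) (abs_nonneg _) hconj).trans ?_
      refine add_le_add (div_le_self (by positivity) hconj.lt.le) ?_
      refine (div_le_self (by positivity) hp.le).trans ?_
      exact Real.rpow_le_rpow (abs_nonneg _) (by linarith [abs_nonneg t]) hp0.le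
    have h2 : |t| ^ (p - 1) * |r| ≤ (|t| + |r|) ^ p := by
      calc |t| ^ (p - 1) * |r| ≤ (|t| + |r|) ^ (p - 1) * (|t| + |r|) := by
            gcongr
            · linarith [abs_nonneg r]
            · linarith [abs_nonneg t]
        _ = (|t| + |r|) ^ p := by
            rw [← Real.rpow_add_one' hm (by simpa using hp0.ne')]; simp
    calc |g x t| * |r| ≤ (|a x| + |b| * |t| ^ (p - 1)) * |r| := by
          gcongr
          refine (hx t).trans (add_le_add (le_abs_self _) ?_)
          gcongr
          exact le_abs_self b
      _ = |a x| * |r| + |b| * (|t| ^ (p - 1) * |r|) := by ring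
      _ ≤ (|a x| ^ q + (|t| + |r|) ^ p) + |b| * (|t| + |r|) ^ p := by gcongr
      _ = _ := by ring

/-- The mean-value bound with `r = t`: for `τ` between `0` and `t`, $|\tau|+|t|\le 2|t|$, whence the
factor $2^p$. -/
lemma abs_primitive_le (hp : 0 < p) {A B : ℝ} (hA : 0 ≤ A) (hB : 0 ≤ B) {x : E N}
    (h : ∀ t r, |g x t| * |r| ≤ A + B * (|t| + |r|) ^ p) (t : ℝ) :
    |primitive g x t| ≤ A + B * 2 ^ p * |t| ^ p := by
  rcases eq_or_ne t 0 with rfl | ht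
  · simp only [primitive, intervalIntegral.integral_same, abs_zero]
    positivity
  · have ht' : 0 < |t| := abs_pos.2 ht
    have := intervalIntegral.norm_integral_le_of_norm_le_const (f := g x) (a := 0) (b := t)
      (C := (A + B * 2 ^ p * |t| ^ p) / |t|) (fun τ hτ => ?_)
    · rw [sub_zero, div_mul_cancel₀ _ ht'.ne'] at this
      exact this
    · rw [Real.norm_eq_abs, le_div_iff₀ ht']
      have hτ' : |τ| ≤ |t| := by
        have := abs_sub_left_of_mem_uIcc (uIoc_subset_uIcc hτ)
        simpa using this
      refine (h τ t).trans ?_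
      rw [mul_assoc, ← Real.mul_rpow (by norm_num) (abs_nonneg _)]
      gcongr
      linarith

lemma hasDerivAt_primitive {x : E N} (hc : Continuous (g x)) (t : ℝ) :
    HasDerivAt (primitive g x) (g x t) t :=
  intervalIntegral.integral_hasDerivAt_right (hc.intervalIntegrable _ _)
    (hc.stronglyMeasurableAtFilter _ _) hc.continuousAt

/-- A negative `limsup` makes the primitive decay like `-|t|^p`. -/
lemma exists_primitive_le (hp : 1 < p) {x : E N} (hc : Continuous (g x))
    (hα : alphaBar p g x < 0) :
    ∃ δ > 0, ∃ c : ℝ, ∀ t, primitive g x t ≤ c - δ * |t| ^ p := by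
  have hp0 : 0 < p := by linarith
  obtain ⟨r, hr1, hr2⟩ := EReal.lt_iff_exists_real_btwn.1 hα
  have hr0 : r < 0 := by exact_mod_cast hr2
  have hev := eventually_lt_of_limsup_lt hr1
  obtain ⟨S, hS, hSsub⟩ := mem_comap.1 hev
  obtain ⟨R₀, hR₀⟩ := mem_atTop_sets.1 hS
  set R := max R₀ 1 with hR
  have hR1 : 1 ≤ R := le_max_right _ _
  have hquot : ∀ t : ℝ, R ≤ |t| → g x t / (|t| ^ (p - 2) * t) < r := by
    intro t ht
    have h1 : t ∈ (fun t : ℝ => |t|) ⁻¹' S := hR₀ _ ((le_max_left _ _).trans ht)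
    have h2 := hSsub h1
    simp only [mem_ofPred_eq] at h2
    exact_mod_cast h2
  -- $H'(t)=g(x,t)-r|t|^{p-2}t$ has the sign opposite to $t$ for $|t|>R$. So the maximum of `H` over
  -- `[-R, R]` is global, and it supplies `c`, with `δ = -r / p`.
  set H : ℝ → ℝ := fun t => primitive g x t + (-r / p) * |t| ^ p with hH
  have hd : ∀ t, HasDerivAt H (g x t + (-r / p) * (p * |t| ^ (p - 2) * t)) t := fun t =>
    (hasDerivAt_primitive hc t).add ((hasDerivAt_abs_rpow t hp).const_mul _)
  have hHc : Continuous H := continuous_iff_continuousAt.2 fun t => (hd t).continuousAt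
  have hform : ∀ t, g x t + (-r / p) * (p * |t| ^ (p - 2) * t) =
      g x t - r * (|t| ^ (p - 2) * t) := by
    intro t; field_simp; ring
  have hanti : AntitoneOn H (Ici R) := by
    refine antitoneOn_of_deriv_nonpos (convex_Ici R) hHc.continuousOn
      (fun t _ => (hd t).differentiableAt.differentiableWithinAt) fun t ht => ?_
    rw [interior_Ici, mem_Ioi] at ht
    have ht0 : 0 < t := by linarith
    rw [(hd t).deriv, hform]
    have hJ : 0 < |t| ^ (p - 2) * t := mul_pos (Real.rpow_pos_of_pos (abs_pos.2 ht0.ne') _) ht0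
    have := (div_lt_iff₀ hJ).1 (hquot t (by rw [abs_of_pos ht0]; exact ht.le))
    linarith
  have hmono : MonotoneOn H (Iic (-R)) := by
    refine monotoneOn_of_deriv_nonneg (convex_Iic (-R)) hHc.continuousOn
      (fun t _ => (hd t).differentiableAt.differentiableWithinAt) fun t ht => ?_
    rw [interior_Iic, mem_Iio] at ht
    have ht0 : t < 0 := by linarith
    rw [(hd t).deriv, hform]
    have hJ : |t| ^ (p - 2) * t < 0 :=
      mul_neg_of_pos_of_neg (Real.rpow_pos_of_pos (abs_pos.2 ht0.ne) _) ht0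
    have := (div_lt_iff_of_neg hJ).1 (hquot t (by rw [abs_of_neg ht0]; linarith))
    linarith
  obtain ⟨m, -, hm⟩ := (isCompact_Icc (a := -R) (b := R)).exists_isMaxOn
    (nonempty_Icc.2 (by linarith)) hHc.continuousOn
  have hmax : ∀ t, H t ≤ H m := by
    intro t
    rcases le_total t (-R) with h1 | h1
    · exact (hmono h1 (mem_Iic.2 le_rfl) h1).trans (hm ⟨le_rfl, by linarith⟩)
    · rcases le_total R t with h2 | h2
      · exact (hanti (mem_Ici.2 le_rfl) h2 h2).trans (hm ⟨by linarith, le_rfl⟩)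
      · exact hm ⟨h1, h2⟩
  refine ⟨-r / p, div_pos (by linarith) hp0, H m, fun t => ?_⟩
  have := hmax t
  simp only [hH] at this ⊢
  linarith

lemma integrableOn_primitive (hp : 0 < p) (hg : IsCaratheodory Ω g) {A : E N → ℝ} {B : ℝ}
    (hA : IntegrableOn A Ω) (hA0 : ∀ x, 0 ≤ A x) (hB : 0 ≤ B)
    (h : ∀ᵐ x ∂(volume.restrict Ω), ∀ t r, |g x t| * |r| ≤ A x + B * (|t| + |r|) ^ p)
    {u : E N → ℝ} (hu : AEMeasurable u (volume.restrict Ω)) (hl : lpPow p Ω u < ∞) :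
    IntegrableOn (fun x => primitive g x (u x)) Ω := by
  refine Integrable.mono' (hA.add ((integrableOn_pow hu hl).const_mul (B * 2 ^ p)))
    (hg.aemeasurable_primitive hu).aestronglyMeasurable ?_
  filter_upwards [h] with x hx
  exact abs_primitive_le hp (hA0 x) hB hx (u x)

/-! ### Differentiation of the energy and the Euler–Lagrange equation. -/

lemma abs_J_mul_le (hp : 1 < p) {c d b : ℝ} (h : |c| ≤ d) (hb : |b| ≤ d) :
    |J p c * b| ≤ d ^ p := by
  have hp0 : 0 < p := by linarith
  have hd : 0 ≤ d := (abs_nonneg c).trans h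
  have hJ : |J p c| ≤ |c| ^ (p - 1) := by
    rcases eq_or_ne c 0 with rfl | hc
    · simp only [J, mul_zero, abs_zero]
      exact Real.rpow_nonneg le_rfl _
    · rw [J, abs_mul, abs_of_nonneg (Real.rpow_nonneg (abs_nonneg c) _)]
      nth_rewrite 2 [← Real.rpow_one |c|]
      rw [← Real.rpow_add (abs_pos.2 hc)]
      ring_nf
      exact le_rfl
  calc |J p c * b| = |J p c| * |b| := abs_mul _ _
    _ ≤ d ^ (p - 1) * d :=
        mul_le_mul (hJ.trans (Real.rpow_le_rpow (abs_nonneg _) h (by linarith))) hb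
          (abs_nonneg _) (Real.rpow_nonneg hd _)
    _ = d ^ p := by
        rw [← Real.rpow_add_one' hd (by simpa using hp0.ne')]; simp

lemma measurable_J : Measurable (J p) := by
  unfold J
  fun_prop

lemma abs_add_mul_le {t a b : ℝ} (ht : t ∈ Metric.ball (0 : ℝ) 1) :
    |a + t * b| ≤ |a| + |b| := by
  have : |t| ≤ 1 := by simpa using (mem_ball_zero_iff.1 ht).le
  calc |a + t * b| ≤ |a| + |t| * |b| := by rw [← abs_mul]; exact abs_add_le _ _
    _ ≤ |a| + 1 * |b| := by gcongr
    _ = _ := by ring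

/-- The Gagliardo energy is differentiable along lines. -/
lemma hasDerivAt_integral_kernel (hp : 1 < p) {u v : E N → ℝ} (hu : MemX s p Ω u)
    (hv : MemX s p Ω v) :
    IntegrableOn (fun z : E N × E N => p * (J p (u z.1 - u z.2) * (v z.1 - v z.2) / weight N s p z))
      (Q Ω) ∧
    HasDerivAt (fun t : ℝ => ∫ z in Q Ω, kernel s p (fun x => u x + t * v x) z)
      (∫ z in Q Ω, p * (J p (u z.1 - u z.2) * (v z.1 - v z.2) / weight N s p z)) 0 := by
  have hp0 : 0 < p := by linarith
  obtain ⟨hum, hug, -⟩ := (memX_iff hp0).1 hu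
  obtain ⟨hvm, hvg, -⟩ := (memX_iff hp0).1 hv
  set F' : ℝ → E N × E N → ℝ := fun t z =>
    p * (J p ((u z.1 - u z.2) + t * (v z.1 - v z.2)) * (v z.1 - v z.2) / weight N s p z) with hF'
  have hmain := hasDerivAt_integral_of_dominated_loc_of_deriv_le
    (μ := (volume : Measure (E N × E N)).restrict (Q Ω)) (x₀ := (0 : ℝ))
    (s := Metric.ball (0 : ℝ) 1)
    (F := fun t z => kernel s p (fun x => u x + t * v x) z) (F' := F')
    (bound := fun z => p * (2 ^ p * (kernel s p u z + kernel s p v z)))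
    (Metric.ball_mem_nhds _ one_pos) ?_ ?_ ?_ ?_ ?_ ?_
  · simpa [hF', IntegrableOn] using hmain
  · exact Eventually.of_forall fun t =>
      (aemeasurable_kernel (hum.add (hvm.const_mul t))).restrict.aestronglyMeasurable
  · simp only [zero_mul, add_zero]
    exact integrableOn_kernel hum hug
  · refine AEMeasurable.aestronglyMeasurable (AEMeasurable.restrict ?_)
    have h1 := aemeasurable_diff hum
    have h2 := aemeasurable_diff hvm
    exact (((measurable_J.comp_aemeasurable (h1.add (h2.const_mul 0))).mul h2).div
      measurable_weight.aemeasurable).const_mul p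
  · refine Eventually.of_forall fun z t ht => ?_
    rw [Real.norm_eq_abs, abs_mul, abs_of_pos hp0, abs_div, abs_of_nonneg (weight_nonneg z)]
    refine mul_le_mul_of_nonneg_left (le_trans ?_ (kernel_add_le hp0 u v z)) hp0.le
    refine div_le_div_of_nonneg_right (abs_J_mul_le hp (abs_add_mul_le ht) ?_) (weight_nonneg z)
    linarith [abs_nonneg (u z.1 - u z.2)]
  · exact ((((integrableOn_kernel hum hug).add (integrableOn_kernel hvm hvg)).const_mul
      (2 ^ p)).const_mul p)
  · refine Eventually.of_forall fun z t _ => ?_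
    have h1 : HasDerivAt (fun t : ℝ => (u z.1 - u z.2) + t * (v z.1 - v z.2))
        (v z.1 - v z.2) t := by
      simpa using ((hasDerivAt_id t).mul_const (v z.1 - v z.2)).const_add (u z.1 - u z.2)
    have h2 := ((hasDerivAt_abs_rpow ((u z.1 - u z.2) + t * (v z.1 - v z.2)) hp).comp t
      h1).div_const (weight N s p z)
    refine HasDerivAt.congr_deriv (HasDerivAt.congr_of_eventuallyEq h2
      (Eventually.of_forall fun τ => ?_)) ?_
    · simp only [kernel, Function.comp_def]
      ring_nf
    · simp only [hF', J]
      ring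

/-- The potential part of the energy is differentiable along lines. -/
lemma hasDerivAt_integral_primitive (hp : 1 < p) (hg : IsCaratheodory Ω g) {A : E N → ℝ} {B : ℝ}
    (hA : IntegrableOn A Ω) (hA0 : ∀ x, 0 ≤ A x) (hB : 0 ≤ B)
    (h : ∀ᵐ x ∂(volume.restrict Ω), ∀ t r, |g x t| * |r| ≤ A x + B * (|t| + |r|) ^ p)
    {u v : E N → ℝ} (hu : AEMeasurable u (volume.restrict Ω)) (hul : lpPow p Ω u < ∞)
    (hv : AEMeasurable v (volume.restrict Ω)) (hvl : lpPow p Ω v < ∞) :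
    IntegrableOn (fun x => g x (u x) * v x) Ω ∧
    HasDerivAt (fun t : ℝ => ∫ x in Ω, primitive g x (u x + t * v x))
      (∫ x in Ω, g x (u x) * v x) 0 := by
  have hp0 : 0 < p := by linarith
  have hmain := hasDerivAt_integral_of_dominated_loc_of_deriv_le
    (μ := (volume : Measure (E N)).restrict Ω) (x₀ := (0 : ℝ))
    (s := Metric.ball (0 : ℝ) 1)
    (F := fun t x => primitive g x (u x + t * v x))
    (F' := fun t x => g x (u x + t * v x) * v x)
    -- For $|t|<1$, $|u+tv|+|v|\le|u|+|2v|$; the inner $2^p$ comes from $|2v|^p$.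
    (bound := fun x => A x + B * (2 ^ p * (|u x| ^ p + 2 ^ p * |v x| ^ p)))
    (Metric.ball_mem_nhds _ one_pos) ?_ ?_ ?_ ?_ ?_ ?_
  · simpa [IntegrableOn] using hmain
  · exact Eventually.of_forall fun t =>
      (hg.aemeasurable_primitive (hu.add (hv.const_mul t))).aestronglyMeasurable
  · simp only [zero_mul, add_zero]
    exact integrableOn_primitive hp0 hg hA hA0 hB h hu hul
  · exact ((hg.aemeasurable_comp (hu.add (hv.const_mul 0))).mul hv).aestronglyMeasurable
  · filter_upwards [h] with x hx t ht
    rw [Real.norm_eq_abs, abs_mul]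
    refine (hx _ _).trans ?_
    gcongr
    have h2 : |2 * v x| = 2 * |v x| := by rw [abs_mul]; norm_num
    calc (|u x + t * v x| + |v x|) ^ p ≤ (|u x| + |2 * v x|) ^ p := by
          refine Real.rpow_le_rpow (by positivity) ?_ hp0.le
          linarith [abs_add_mul_le (a := u x) (b := v x) ht]
      _ ≤ 2 ^ p * (|u x| ^ p + |2 * v x| ^ p) := abs_add_rpow_le hp0 _ _
      _ = _ := by rw [h2, Real.mul_rpow (by norm_num) (abs_nonneg _)]
  · exact hA.add ((((integrableOn_pow hu hul).add
      ((integrableOn_pow hv hvl).const_mul (2 ^ p))).const_mul (2 ^ p)).const_mul B)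
  · filter_upwards [hg.continuous] with x hx t _
    have h1 : HasDerivAt (fun t : ℝ => u x + t * v x) (v x) t := by
      simpa using ((hasDerivAt_id t).mul_const (v x)).const_add (u x)
    exact (hasDerivAt_primitive hx (u x + t * v x)).comp t h1

/-- Minimizers of the energy solve the Neumann problem weakly. -/
lemma isWeakSolution_of_minimizer (hp : 1 < p) (hg : IsCaratheodory Ω g)
    (hgr : HasPLinearGrowth p Ω g) {u : E N → ℝ} (hu : MemX s p Ω u)
    (hmin : ∀ v, MemX s p Ω v → energy s p Ω g u ≤ energy s p Ω g v) :
    IsWeakSolution s p Ω g u := by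
  have hp0 : 0 < p := by linarith
  obtain ⟨A, B, hA, hA0, hB, h⟩ := hgr.exists_bound hp hg
  refine ⟨hu, fun v hv => ?_⟩
  obtain ⟨hum, hug, hul⟩ := (memX_iff hp0).1 hu
  obtain ⟨hvm, hvg, hvl⟩ := (memX_iff hp0).1 hv
  obtain ⟨hi1, hd1⟩ := hasDerivAt_integral_kernel hp hu hv
  obtain ⟨hi2, hd2⟩ := hasDerivAt_integral_primitive hp hg hA hA0 hB h hum.restrict hul
    hvm.restrict hvl
  refine ⟨?_, hi2, ?_⟩
  · refine (hi1.const_mul p⁻¹).congr (Eventually.of_forall fun z => ?_)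
    simp only
    rw [inv_mul_cancel_left₀ hp0.ne']
  -- The factor `p` from differentiating $|\cdot|^p$ turns `1 / (2 * p)` into `1 / 2`.
  · have hd := (hd1.const_mul (1 / (2 * p))).sub hd2
    have hloc : IsLocalMin (fun t : ℝ => energy s p Ω g fun x => u x + t * v x) 0 := by
      refine Eventually.of_forall fun t => ?_
      have := hmin _ (memX_add hp0 hu (memX_smul hp0 t hv))
      simpa using this
    have hzero := hloc.hasDerivAt_eq_zero hd
    rw [integral_const_mul] at hzero
    have : (1 : ℝ) / (2 * p) * (p * ∫ z in Q Ω,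
        J p (u z.1 - u z.2) * (v z.1 - v z.2) / weight N s p z) =
        1 / 2 * ∫ z in Q Ω, J p (u z.1 - u z.2) * (v z.1 - v z.2) / weight N s p z := by
      field_simp
    linarith

/-! ### Coercivity. -/

/-- Coercivity of the energy, proved by normalising a hypothetical unbounded sequence. -/
lemma exists_sublevel_bound (hp : 1 < p) (hs : 0 < s) (hΩ : MeasurableSet Ω)
    (hb : Bornology.IsBounded Ω) (h0 : volume Ω ≠ 0) (hg : IsCaratheodory Ω g)
    (hgr : HasPLinearGrowth p Ω g)
    (hα : ∀ᵐ x ∂(volume.restrict Ω), alphaBar p g x < 0) :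
    ∃ M : ℝ, ∀ u, Measurable u → MemX s p Ω u → energy s p Ω g u ≤ 0 →
      (gagl s p Ω u).toReal + (lpPow p Ω u).toReal ≤ M := by
  have hp0 : 0 < p := by linarith
  obtain ⟨A, B, hA, hA0, hB, h⟩ := hgr.exists_bound hp hg
  set μ := (volume : Measure (E N)).restrict Ω with hμ
  set B' := B * 2 ^ p with hB'
  have hB'0 : 0 ≤ B' := by positivity
  by_contra! hcon
  choose u hum huX hue huM using fun n : ℕ => hcon (n + 1)
  set S : ℕ → ℝ := fun n => (gagl s p Ω (u n)).toReal + (lpPow p Ω (u n)).toReal with hS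
  have hSpos : ∀ n, 0 < S n := fun n => lt_trans (by positivity) (huM n)
  have hSinv : Tendsto (fun n => (S n)⁻¹) atTop (𝓝 0) := by
    refine tendsto_inv_atTop_zero.comp (tendsto_atTop_mono (fun n => ?_)
      tendsto_natCast_atTop_atTop)
    have := huM n
    linarith
  -- Chosen so that the two parts `a n`, `b n` of the rescaled function add up to `1`.
  set c : ℕ → ℝ := fun n => (S n)⁻¹ ^ (1 / p) with hc
  have hcpow : ∀ n, |c n| ^ p = (S n)⁻¹ := by
    intro n
    have h1 : 0 ≤ (S n)⁻¹ := inv_nonneg.2 (hSpos n).le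
    rw [abs_of_nonneg (Real.rpow_nonneg h1 _), ← Real.rpow_mul h1,
      one_div_mul_cancel hp0.ne', Real.rpow_one]
  set v : ℕ → E N → ℝ := fun n x => c n * u n x with hv
  have hvm : ∀ n, Measurable (v n) := fun n => (hum n).const_mul _
  have hvpow : ∀ n x, |v n x| ^ p = (S n)⁻¹ * |u n x| ^ p := by
    intro n x
    rw [hv, abs_mul, Real.mul_rpow (abs_nonneg _) (abs_nonneg _), hcpow]
  have hfin : ∀ n, gagl s p Ω (u n) < ∞ ∧ lpPow p Ω (u n) < ∞ :=
    fun n => ((memX_iff hp0).1 (huX n)).2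
  have hgv : ∀ n, gagl s p Ω (v n) = ENNReal.ofReal ((S n)⁻¹ * (gagl s p Ω (u n)).toReal) := by
    intro n
    rw [hv, gagl_smul, hcpow, ENNReal.ofReal_mul (inv_nonneg.2 (hSpos n).le),
      ENNReal.ofReal_toReal (hfin n).1.ne]
  have hlv : ∀ n, lpPow p Ω (v n) = ENNReal.ofReal ((S n)⁻¹ * (lpPow p Ω (u n)).toReal) := by
    intro n
    rw [hv, lpPow_smul, hcpow, ENNReal.ofReal_mul (inv_nonneg.2 (hSpos n).le),
      ENNReal.ofReal_toReal (hfin n).2.ne]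
  set a : ℕ → ℝ := fun n => (S n)⁻¹ * (gagl s p Ω (u n)).toReal with ha
  set b : ℕ → ℝ := fun n => (S n)⁻¹ * (lpPow p Ω (u n)).toReal with hbdef
  have ha0 : ∀ n, 0 ≤ a n := fun n =>
    mul_nonneg (inv_nonneg.2 (hSpos n).le) ENNReal.toReal_nonneg
  have hb0 : ∀ n, 0 ≤ b n := fun n =>
    mul_nonneg (inv_nonneg.2 (hSpos n).le) ENNReal.toReal_nonneg
  have hab : ∀ n, a n + b n = 1 := by
    intro n
    rw [ha, hbdef, ← mul_add]
    exact inv_mul_cancel₀ (hSpos n).ne'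
  obtain ⟨φ, w, hφ, hwm, hwfin, hlim, hae⟩ := exists_subseq_tendsto hp.le hs hΩ hb h0 hvm
    ENNReal.one_ne_top
    (fun n => by
      rw [hlv]; exact ENNReal.ofReal_le_one.2 (by linarith [hab n, ha0 n]))
    (fun n => by
      rw [hgv]; exact ENNReal.ofReal_le_one.2 (by linarith [hab n, hb0 n]))
  have hblim : Tendsto (fun n => b (φ n)) atTop (𝓝 (lpPow p Ω w).toReal) := by
    refine ((ENNReal.tendsto_toReal hwfin).comp hlim).congr fun n => ?_
    rw [Function.comp_apply, hlv, ENNReal.toReal_ofReal (hb0 _)]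
  set f : ℕ → E N → ℝ := fun n x => (S n)⁻¹ * primitive g x (u n x) with hf
  have hGint : ∀ n, IntegrableOn (fun x => primitive g x (u n x)) Ω := fun n =>
    integrableOn_primitive hp0 hg hA hA0 hB h (hum n).aemeasurable (hfin n).2
  have hfint : ∀ n, IntegrableOn (f n) Ω := fun n => (hGint n).const_mul _
  have hf_lower : ∀ n, 1 / (2 * p) * a n ≤ ∫ x in Ω, f n x := by
    intro n
    have h1 := hue n
    rw [energy_eq (hum n).aemeasurable, sub_nonpos] at h1
    rw [hf, integral_const_mul, ha]
    calc _ = (S n)⁻¹ * (1 / (2 * p) * (gagl s p Ω (u n)).toReal) := by ring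
      _ ≤ _ := mul_le_mul_of_nonneg_left h1 (inv_nonneg.2 (hSpos n).le)
  have hf_abs : ∀ n, ∀ᵐ x ∂μ, |f n x| ≤ (S n)⁻¹ * A x + B' * |v n x| ^ p := by
    intro n
    filter_upwards [h] with x hx
    rw [hf, abs_mul, abs_of_nonneg (inv_nonneg.2 (hSpos n).le), hvpow]
    calc _ ≤ (S n)⁻¹ * (A x + B' * |u n x| ^ p) :=
          mul_le_mul_of_nonneg_left (abs_primitive_le hp0 (hA0 x) hB hx _)
            (inv_nonneg.2 (hSpos n).le)
      _ = _ := by ring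
  have hvint : ∀ n, IntegrableOn (fun x => |v n x| ^ p) Ω := fun n =>
    integrableOn_pow (hvm n).aemeasurable (by rw [hlv]; exact ENNReal.ofReal_lt_top)
  have hDint : ∀ n, IntegrableOn (fun x => (S n)⁻¹ * A x + B' * |v n x| ^ p) Ω := fun n =>
    (hA.const_mul _).add ((hvint n).const_mul _)
  have hDval : ∀ n, ∫ x in Ω, ((S n)⁻¹ * A x + B' * |v n x| ^ p) =
      (S n)⁻¹ * (∫ x in Ω, A x) + B' * b n := by
    intro n
    rw [integral_add (hA.const_mul _) ((hvint n).const_mul _), integral_const_mul,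
      integral_const_mul, integral_pow (hvm n).aemeasurable, hlv, ENNReal.toReal_ofReal (hb0 n)]
  have hSφ : Tendsto (fun n => (S (φ n))⁻¹) atTop (𝓝 0) := hSinv.comp hφ.tendsto_atTop
  have hDlim : Tendsto (fun n => (S (φ n))⁻¹ * (∫ x in Ω, A x) + B' * b (φ n)) atTop
      (𝓝 (B' * (lpPow p Ω w).toReal)) := by
    simpa using (hSφ.mul_const (∫ x in Ω, A x)).add (hblim.const_mul B')
  -- Nonnegative a.e. by the growth bound, so Fatou applies. Nonpositive energy makes the integral
  -- of `f n` nonnegative, so the limit integral is at most that of $B'|w|^p$.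
  set H : ℕ → E N → ℝ := fun n x => (S n)⁻¹ * A x + B' * |v n x| ^ p - f n x with hH
  have hHm : ∀ n, AEMeasurable (fun x => ENNReal.ofReal (H n x)) μ := fun n =>
    ((hDint n).sub (hfint n)).aestronglyMeasurable.aemeasurable.ennreal_ofReal
  have hHint : ∀ n, ∫⁻ x in Ω, ENNReal.ofReal (H n x) ≤
      ENNReal.ofReal ((S n)⁻¹ * (∫ x in Ω, A x) + B' * b n) := by
    intro n
    rw [← ofReal_integral_eq_lintegral_ofReal (f := H n) ((hDint n).sub (hfint n))]
    · refine ENNReal.ofReal_le_ofReal ?_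
      rw [hH, integral_sub (hDint n) (hfint n), hDval]
      have h1 : 0 ≤ 1 / (2 * p) * a n := mul_nonneg (by positivity) (ha0 n)
      linarith [hf_lower n]
    · filter_upwards [hf_abs n] with x hx
      simp only [hH, Pi.zero_apply]
      linarith [le_abs_self (f n x)]
  have hwint : IntegrableOn (fun x => |w x| ^ p) Ω := integrableOn_pow hwm hwfin.lt_top
  have hFatou : ∫⁻ x in Ω, liminf (fun n => ENNReal.ofReal (H (φ n) x)) atTop ≤
      ∫⁻ x in Ω, ENNReal.ofReal (B' * |w x| ^ p) := by
    rw [← ofReal_integral_eq_lintegral_ofReal (hwint.const_mul B')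
      (Eventually.of_forall fun x => by positivity), integral_const_mul, integral_pow hwm]
    refine (lintegral_liminf_le' fun n => hHm (φ n)).trans ?_
    refine (liminf_le_liminf (Eventually.of_forall fun n => hHint (φ n))).trans ?_
    exact (((ENNReal.continuous_ofReal.tendsto _).comp hDlim).liminf_eq).le
  -- `δ` depends on `x` and need not be measurable: only $B'|w|^p$ and the liminf are integrated.
  -- Their a.e. equality then contradicts `δ > 0` wherever `w` is nonzero.
  have hpt : ∀ᵐ x ∂μ, ∃ δ > 0, ENNReal.ofReal ((B' + δ) * |w x| ^ p) ≤
      liminf (fun n => ENNReal.ofReal (H (φ n) x)) atTop := by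
    filter_upwards [hα, hg.continuous, hae] with x hx1 hx2 hx3
    obtain ⟨δ, hδ, k, hk⟩ := exists_primitive_le hp hx2 hx1
    refine ⟨δ, hδ, ?_⟩
    have hpw : Tendsto (fun n => |v (φ n) x| ^ p) atTop (𝓝 (|w x| ^ p)) :=
      hx3.abs.rpow_const (Or.inr hp0.le)
    have h1 : Tendsto (fun n => ENNReal.ofReal
        ((S (φ n))⁻¹ * (A x - k) + (B' + δ) * |v (φ n) x| ^ p)) atTop
        (𝓝 (ENNReal.ofReal ((B' + δ) * |w x| ^ p))) := by
      refine (ENNReal.continuous_ofReal.tendsto _).comp ?_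
      simpa using (hSφ.mul_const (A x - k)).add (hpw.const_mul (B' + δ))
    rw [← h1.liminf_eq]
    refine liminf_le_liminf (Eventually.of_forall fun n => ENNReal.ofReal_le_ofReal ?_)
    have h2 := mul_le_mul_of_nonneg_left (hk (u (φ n) x)) (inv_nonneg.2 (hSpos (φ n)).le)
    have h3 := hvpow (φ n) x
    simp only [hH, hf]
    have h4 : (S (φ n))⁻¹ * (k - δ * |u (φ n) x| ^ p) =
        (S (φ n))⁻¹ * k - δ * |v (φ n) x| ^ p := by rw [h3]; ring
    rw [h4] at h2
    linarith
  have hle : (fun x => ENNReal.ofReal (B' * |w x| ^ p)) ≤ᵐ[μ]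
      fun x => liminf (fun n => ENNReal.ofReal (H (φ n) x)) atTop := by
    filter_upwards [hpt] with x hx
    obtain ⟨δ, hδ, hx⟩ := hx
    refine le_trans (ENNReal.ofReal_le_ofReal ?_) hx
    gcongr
    linarith
  have hliminf : AEMeasurable
      (fun x => liminf (fun n => ENNReal.ofReal (H (φ n) x)) atTop) μ := by
    refine ⟨fun x => liminf (fun n => (hHm (φ n)).mk _ x) atTop,
      Measurable.liminf fun n => (hHm (φ n)).measurable_mk, ?_⟩
    filter_upwards [ae_all_iff.2 fun n => (hHm (φ n)).ae_eq_mk] with x hx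
    simp_rw [hx]
  have heq := ae_eq_of_ae_le_of_lintegral_le hle
    (hwint.const_mul B').lintegral_lt_top.ne hliminf hFatou
  have hw0 : lpPow p Ω w = 0 := by
    have hz : ∀ᵐ x ∂μ, ENNReal.ofReal (|w x| ^ p) = 0 := by
      filter_upwards [hpt, heq] with x hx hx'
      obtain ⟨δ, hδ, hx⟩ := hx
      rw [← hx', ENNReal.ofReal_le_ofReal_iff (by positivity)] at hx
      refine ENNReal.ofReal_eq_zero.2 ?_
      by_contra! hpos
      nlinarith
    exact (lintegral_congr_ae hz).trans (by simp)
  rw [hw0, ENNReal.toReal_zero] at hblim hDlim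
  rw [mul_zero] at hDlim
  have halim : Tendsto (fun n => 1 / (2 * p) * a (φ n)) atTop (𝓝 (1 / (2 * p) * (1 - 0))) := by
    refine Tendsto.const_mul _ ((hblim.const_sub 1).congr fun n => ?_)
    linarith [hab (φ n)]
  -- With `w = 0`, `a` tends to `1` along `φ`, while $a/(2p)\le\int f$ and the upper bound of $\int
  -- f$ tends to `0`.
  have hcontra := le_of_tendsto_of_tendsto' halim hDlim fun n => by
    refine (hf_lower (φ n)).trans ?_
    rw [← hDval]
    refine integral_mono_ae (hfint _) (hDint _) ?_
    filter_upwards [hf_abs (φ n)] with x hx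
    exact (le_abs_self _).trans hx
  have : 0 < 1 / (2 * p) * (1 - 0) := by
    rw [sub_zero, mul_one]; positivity
  linarith

/-! ### The direct method. -/

lemma eventually_sub_lt_toReal {x : ℝ≥0∞} {y : ℕ → ℝ≥0∞} (hx : x ≠ ∞) (hy : ∀ n, y n ≠ ∞)
    (h : x ≤ liminf y atTop) {ε : ℝ} (hε : 0 < ε) :
    ∀ᶠ n in atTop, x.toReal - ε < (y n).toReal := by
  rcases lt_or_ge (x.toReal - ε) 0 with hneg | hpos
  · exact Eventually.of_forall fun n => hneg.trans_le ENNReal.toReal_nonneg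
  · have hlt : ENNReal.ofReal (x.toReal - ε) < liminf y atTop :=
      ((ENNReal.ofReal_lt_iff_lt_toReal hpos hx).2 (by linarith)).trans_le h
    filter_upwards [eventually_lt_of_lt_liminf hlt] with n hn
    exact (ENNReal.ofReal_lt_iff_lt_toReal hpos (hy n)).1 hn

/-- Upper semicontinuity of the potential along sequences that converge in `L^p(Ω)`. -/
lemma eventually_integral_primitive_lt (hp : 1 < p) (hg : IsCaratheodory Ω g)
    (hgr : HasPLinearGrowth p Ω g) {u : ℕ → E N → ℝ} {v : E N → ℝ}
    (hu : ∀ n, AEMeasurable (u n) (volume.restrict Ω)) (hul : ∀ n, lpPow p Ω (u n) < ∞)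
    (hv : AEMeasurable v (volume.restrict Ω)) (hvl : lpPow p Ω v < ∞)
    (hlim : Tendsto (fun n => lpPow p Ω (u n)) atTop (𝓝 (lpPow p Ω v)))
    (hae : ∀ᵐ x ∂(volume.restrict Ω), Tendsto (fun n => u n x) atTop (𝓝 (v x)))
    {ε : ℝ} (hε : 0 < ε) :
    ∀ᶠ n in atTop, ∫ x in Ω, primitive g x (u n x) < (∫ x in Ω, primitive g x (v x)) + ε := by
  have hp0 : 0 < p := by linarith
  obtain ⟨A, B, hA, hA0, hB, h⟩ := hgr.exists_bound hp hg
  set B' := B * 2 ^ p with hB'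
  -- Fatou for this a.e. nonnegative integrand; the added term $B'\int|u_n|^p$ converges and can be
  -- removed again.
  set H : (E N → ℝ) → E N → ℝ := fun w x => A x + B' * |w x| ^ p - primitive g x (w x) with hH
  have hDint : ∀ {w : E N → ℝ}, AEMeasurable w (volume.restrict Ω) → lpPow p Ω w < ∞ →
      IntegrableOn (fun x => A x + B' * |w x| ^ p) Ω := fun hw hwl =>
    hA.add ((integrableOn_pow hw hwl).const_mul _)
  have hHint : ∀ {w : E N → ℝ}, AEMeasurable w (volume.restrict Ω) → lpPow p Ω w < ∞ →
      IntegrableOn (H w) Ω := fun hw hwl =>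
    (hDint hw hwl).sub (integrableOn_primitive hp0 hg hA hA0 hB h hw hwl)
  have hH0 : ∀ w : E N → ℝ, 0 ≤ᵐ[volume.restrict Ω] H w := by
    intro w
    filter_upwards [h] with x hx
    have := abs_primitive_le hp0 (hA0 x) hB hx (w x)
    simp only [hH, Pi.zero_apply]
    linarith [le_abs_self (primitive g x (w x))]
  have hHval : ∀ {w : E N → ℝ}, AEMeasurable w (volume.restrict Ω) → lpPow p Ω w < ∞ →
      (∫⁻ x in Ω, ENNReal.ofReal (H w x)).toReal = (∫ x in Ω, A x) + B' * (lpPow p Ω w).toReal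
        - ∫ x in Ω, primitive g x (w x) := by
    intro w hw hwl
    rw [← integral_eq_lintegral_of_nonneg_ae (hH0 w) (hHint hw hwl).aestronglyMeasurable, hH,
      integral_sub (hDint hw hwl) (integrableOn_primitive hp0 hg hA hA0 hB h hw hwl),
      integral_add hA ((integrableOn_pow hw hwl).const_mul _), integral_const_mul, integral_pow hw]
  have hFatou : ∫⁻ x in Ω, ENNReal.ofReal (H v x) ≤
      liminf (fun n => ∫⁻ x in Ω, ENNReal.ofReal (H (u n) x)) atTop := by
    refine le_trans (le_of_eq (lintegral_congr_ae ?_)) (lintegral_liminf_le' fun n =>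
      (hHint (hu n) (hul n)).aestronglyMeasurable.aemeasurable.ennreal_ofReal)
    filter_upwards [hae, hg.continuous] with x hx hc
    have hG : Continuous (primitive g x) :=
      continuous_iff_continuousAt.2 fun t => (hasDerivAt_primitive hc t).continuousAt
    have h1 : Tendsto (fun n => H (u n) x) atTop (𝓝 (H v x)) :=
      (((hx.abs.rpow_const (Or.inr hp0.le)).const_mul B').const_add (A x)).sub
        ((hG.tendsto _).comp hx)
    exact (((ENNReal.continuous_ofReal.tendsto _).comp h1).liminf_eq).symm
  have h1 := eventually_sub_lt_toReal (hHint hv hvl).lintegral_lt_top.ne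
    (fun n => (hHint (hu n) (hul n)).lintegral_lt_top.ne) hFatou (half_pos hε)
  have h2 : Tendsto (fun n => B' * (lpPow p Ω (u n)).toReal) atTop
      (𝓝 (B' * (lpPow p Ω v).toReal)) :=
    ((ENNReal.tendsto_toReal hvl.ne).comp hlim).const_mul B'
  have h3 := h2.eventually_lt_const
    (show B' * (lpPow p Ω v).toReal < B' * (lpPow p Ω v).toReal + ε / 2 by linarith)
  filter_upwards [h1, h3] with n hn1 hn3
  rw [hHval hv hvl, hHval (hu n) (hul n)] at hn1
  linarith

/-- Existence of a global minimizer by the direct method. -/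
lemma exists_minimizer (hp : 1 < p) (hs : 0 < s) (hΩ : MeasurableSet Ω)
    (hb : Bornology.IsBounded Ω) (h0 : volume Ω ≠ 0) (hg : IsCaratheodory Ω g)
    (hgr : HasPLinearGrowth p Ω g)
    (hα : ∀ᵐ x ∂(volume.restrict Ω), alphaBar p g x < 0) :
    ∃ u, MemX s p Ω u ∧ ∀ v, MemX s p Ω v → energy s p Ω g u ≤ energy s p Ω g v := by
  have hp0 : 0 < p := by linarith
  obtain ⟨M, hM⟩ := exists_sublevel_bound hp hs hΩ hb h0 hg hgr hα
  obtain ⟨A, B, hA, hA0, hB, h⟩ := hgr.exists_bound hp hg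
  -- Only nonpositive energies, where the coercivity bound holds; the zero function shows that
  -- nothing is lost.
  set 𝒮 : Set ℝ := {e | ∃ u, Measurable u ∧ MemX s p Ω u ∧ energy s p Ω g u ≤ 0 ∧
    energy s p Ω g u = e} with h𝒮
  have hzero : (0 : ℝ) ∈ 𝒮 := by
    have hX : MemX s p Ω (fun _ : E N => (0 : ℝ)) := by
      rw [memX_iff hp0]
      refine ⟨aemeasurable_const, ?_, ?_⟩ <;>
      simp [gagl, lpPow, kernel, Real.zero_rpow hp0.ne']
    have he : energy s p Ω g (fun _ : E N => (0 : ℝ)) = 0 := by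
      simp [energy, primitive, Real.zero_rpow hp0.ne']
    exact ⟨fun _ => 0, measurable_const, hX, he.le, he⟩
  have hbdd : BddBelow 𝒮 := by
    refine ⟨-((∫ x in Ω, A x) + B * 2 ^ p * M), ?_⟩
    rintro _ ⟨u, hum, huX, hu0, rfl⟩
    obtain ⟨-, hug, hul⟩ := (memX_iff hp0).1 huX
    have h1 : ∫ x in Ω, primitive g x (u x) ≤ ∫ x in Ω, (A x + B * 2 ^ p * |u x| ^ p) := by
      refine integral_mono_ae (integrableOn_primitive hp0 hg hA hA0 hB h hum.aemeasurable hul)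
        (hA.add ((integrableOn_pow hum.aemeasurable hul).const_mul _)) ?_
      filter_upwards [h] with x hx
      exact (le_abs_self _).trans (abs_primitive_le hp0 (hA0 x) hB hx (u x))
    rw [integral_add hA ((integrableOn_pow hum.aemeasurable hul).const_mul _),
      integral_const_mul, integral_pow hum.aemeasurable] at h1
    have h2 : B * 2 ^ p * (lpPow p Ω u).toReal ≤ B * 2 ^ p * M := by
      refine mul_le_mul_of_nonneg_left ?_ (by positivity)
      have := hM u hum huX hu0
      linarith [ENNReal.toReal_nonneg (a := gagl s p Ω u)]
    rw [energy_eq hum.aemeasurable]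
    have h3 : 0 ≤ 1 / (2 * p) * (gagl s p Ω u).toReal := by positivity
    linarith
  obtain ⟨e, -, he, hmem⟩ := exists_seq_tendsto_sInf ⟨0, hzero⟩ hbdd
  choose u hum huX hu0 hue using hmem
  have hfin : ∀ n, gagl s p Ω (u n) < ∞ ∧ lpPow p Ω (u n) < ∞ :=
    fun n => ((memX_iff hp0).1 (huX n)).2
  have hgle : ∀ n, gagl s p Ω (u n) ≤ ENNReal.ofReal M := fun n => by
    refine (ENNReal.le_ofReal_iff_toReal_le (hfin n).1.ne ?_).2 ?_ <;>
    linarith [hM (u n) (hum n) (huX n) (hu0 n), ENNReal.toReal_nonneg (a := gagl s p Ω (u n)),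
      ENNReal.toReal_nonneg (a := lpPow p Ω (u n))]
  have hlle : ∀ n, lpPow p Ω (u n) ≤ ENNReal.ofReal M := fun n => by
    refine (ENNReal.le_ofReal_iff_toReal_le (hfin n).2.ne ?_).2 ?_ <;>
    linarith [hM (u n) (hum n) (huX n) (hu0 n), ENNReal.toReal_nonneg (a := gagl s p Ω (u n)),
      ENNReal.toReal_nonneg (a := lpPow p Ω (u n))]
  obtain ⟨φ, w, hφ, hwm, hwfin, hlim, hae⟩ := exists_subseq_tendsto hp.le hs hΩ hb h0 hum
    ENNReal.ofReal_ne_top hlle hgle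
  obtain ⟨v, hvm, hvw, hvg⟩ := exists_extension_gagl_le_liminf hp0 hs hΩ hb h0
    (fun n => hum (φ n)) hae ENNReal.ofReal_ne_top (fun n => hlle (φ n))
  have hvl : lpPow p Ω v = lpPow p Ω w := lpPow_congr hvw
  have hvgfin : gagl s p Ω v < ∞ := by
    refine (hvg.trans (liminf_le_of_frequently_le' (x := ENNReal.ofReal M)
      (Frequently.of_forall fun n => hgle (φ n)))).trans_lt ENNReal.ofReal_lt_top
  have hvX : MemX s p Ω v :=
    (memX_iff hp0).2 ⟨hvm.aemeasurable, hvgfin, by rw [hvl]; exact hwfin.lt_top⟩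
  have hae' : ∀ᵐ x ∂(volume.restrict Ω), Tendsto (fun n => u (φ n) x) atTop (𝓝 (v x)) := by
    filter_upwards [hae, hvw] with x hx hx'
    rwa [hx']
  have hle : energy s p Ω g v ≤ sInf 𝒮 := by
    refine le_of_forall_pos_le_add fun ε hε => ?_
    have h1 := eventually_sub_lt_toReal hvgfin.ne (fun n => (hfin (φ n)).1.ne) hvg
      -- After multiplication by `1 / (2 * p)` the loss is `ε / 2`.
      (ε := p * ε) (by positivity)
    have h2 := eventually_integral_primitive_lt hp hg hgr
      (fun n => (hum (φ n)).aemeasurable) (fun n => (hfin (φ n)).2) hvm.aemeasurable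
      (by rw [hvl]; exact hwfin.lt_top) (by rw [hvl]; exact hlim) hae' (half_pos hε)
    refine ge_of_tendsto ((he.comp hφ.tendsto_atTop).add_const ε) ?_
    filter_upwards [h1, h2] with n hn1 hn2
    rw [Function.comp_apply, ← hue, energy_eq hvm.aemeasurable, energy_eq (hum _).aemeasurable]
    have h3 := mul_lt_mul_of_pos_left hn1 (show 0 < 1 / (2 * p) by positivity)
    have h4 : 1 / (2 * p) * ((gagl s p Ω v).toReal - p * ε) =
        1 / (2 * p) * (gagl s p Ω v).toReal - ε / 2 := by field_simp
    linarith
  have hInf0 : sInf 𝒮 ≤ 0 := csInf_le hbdd hzero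
  refine ⟨v, hvX, fun v' hv' => hle.trans ?_⟩
  rcases le_or_gt (energy s p Ω g v') 0 with hneg | hpos
  · have heq := hv'.1.ae_eq_mk
    refine csInf_le hbdd ⟨hv'.1.mk v', hv'.1.measurable_mk, memX_congr hp0 heq hv', ?_,
      (energy_congr heq).symm⟩
    rwa [← energy_congr heq]
  · exact hInf0.trans hpos.le

end FracNeumann

end

theorem theorem4p1 {N : ℕ} (hN : 1 ≤ N) (s p : ℝ) (hs₀ : 0 < s) (hs₁ : s < 1) (hp : 1 < p)
    (Ω : Set (FracNeumann.E N)) (hΩ : FracNeumann.IsBoundedLipschitzDomain Ω)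
    (g : FracNeumann.E N → ℝ → ℝ) (hg : FracNeumann.IsCaratheodory Ω g)
    (hgrowth : FracNeumann.HasPLinearGrowth p Ω g)
    (halpha : ∀ᵐ x ∂(MeasureTheory.volume.restrict Ω), FracNeumann.alphaBar p g x < 0) :
    ∃ u : FracNeumann.E N → ℝ,
      FracNeumann.IsWeakSolution s p Ω g u ∧ FracNeumann.IsGlobalMinimizer s p Ω g u := by
  have hp0 : 0 < p := by linarith
  have h0 : volume Ω ≠ 0 := (hΩ.isOpen.measure_pos volume hΩ.isConnected.nonempty).ne'
  obtain ⟨u, huX, hu⟩ := FracNeumann.exists_minimizer hp hs₀ hΩ.isOpen.measurableSet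
    hΩ.isBounded h0 hg hgrowth halpha
  obtain ⟨A, B, hA, hA0, hB, h⟩ := hgrowth.exists_bound hp hg
  refine ⟨u, FracNeumann.isWeakSolution_of_minimizer hp hg hgrowth huX hu, huX,
    fun v hv => ?_⟩
  obtain ⟨hvm, hvg, hvl⟩ := (FracNeumann.memX_iff hp0).1 hv
  exact ⟨FracNeumann.integrableOn_kernel hvm hvg,
    FracNeumann.integrableOn_primitive hp0 hg hA hA0 hB h hvm.restrict hvl, hu v hv⟩
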